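/- Let $n\ge 2$, let $\mathbb B^n$ be the open unit ball of $\mathbb R^n$, $\sigma_{k}=2\pi^{(k+1)/2}/\Gamma((k+1)/2)$ for $k\ge 1$, and $\sigma_0=0$ by convention. For a compact set $K$ contained in an open set $O\subseteq\mathbb R^n$, let $\mathrm{ncap}(O,K)=\inf_u\int_{\mathbb R^n}|\nabla u|^n\,dV$, the infimum being over all continuous $u:\mathbb R^n\to[0,1]$ that are absolutely continuous on almost all lines parallel to the coordinate axes, vanish on $K$, and for which the closure of $\{u<1\}$ is a compact subset of $O$. Put $\mathrm{nmod}(O,K)=\big(\mathrm{ncap}(O,K)/\sigma_{n-1}\big)^{1/(1-n)}$ and $$\mathrm{ncap}_1(K)=\exp\Big(-\lim_{r\to\infty}\big(\mathrm{nmod}(r\mathbb B^n,K)-\ln r\big)\Big).$$ Let $$\mathrm{nrob}(K)=\inf_\mu\int\!\!\int\ln\frac1{|x-y|}\,d\mu(x)\,d\mu(y),\qquad \mathrm{ncap}_3(K)=\exp(-\mathrm{nrob}(K)),$$ the infimum being over all Borel probability measures $\mu$ carried by $K$, and let $$\mathrm{nmd}(O,K)=\inf_{\nu}\int\!\!\int\ln\frac1{|x-y|}\,d\nu(x)\,d\nu(y),$$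 the infimum being over all signed measures $\nu=\nu_K-\nu_O$, with $\nu_K$ and $\nu_O$ Borel probability measures carried by $K$ and by $\mathbb R^n\setminus O$ respectively, for which the integral is defined. Values and limits are taken in $[-\infty,\infty]$, with $\inf\emptyset=+\infty$ and $\exp(-\infty)=0$. (i) For every compact $K\subset\mathbb R^n$ the limit $\lim_{r\to\infty}\big(\mathrm{nmd}(r\mathbb B^n,K)-\ln r\big)$ exists in $[-\infty,\infty]$ and $$\mathrm{ncap}_3(K)=\frac{\exp\Big(-\lim_{r\to\infty}\big(\mathrm{nmd}(r\mathbb B^n,K)-\ln r\big)\Big)}{\mathrm{ncap}_3(\overline{\mathbb B^n})}.$$ (ii) For every $r>0$ the limit defining $\mathrm{ncap}_1(r\overline{\mathbb B^n})$ exists, and $$\mathrm{ncap}_1(r\overline{\mathbb B^n})=r,\qquad \mathrm{ncap}_3(r\overline{\mathbb B^n})=r\exp\left(\frac{\sigma_{n-2}}{2\sigma_{n-1}}\int_0^\pi(\sin\theta)^{n-2}\ln\big(2(1-\cos\theta)\big)\,d\theta\right).$$ Moreover $\mathrm{ncap}_1(r\overline{\mathbb B^n})=\mathrm{ncap}_3(r\overline{\mathbb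 B^n})$ if and only if $n=2$. -/

import Mathlib

open MeasureTheory Filter Topology
open scoped ENNReal

namespace ConformalCapacity

noncomputable section

/-- `σ_k`: the surface area `2 π^{(k+1)/2} / Γ((k+1)/2)` of the unit sphere of `ℝ^{k+1}` for `k ≥ 1`,
with the convention `σ_0 = 0`. -/
def sphereArea (k : ℕ) : ℝ :=
  if k = 0 then 0
  else 2 * Real.pi ^ (((k : ℝ) + 1) / 2) / Real.Gamma (((k : ℝ) + 1) / 2)

/-! ### Conformal capacity of a condenser, conformal modulus, and the first capacity -/

/-- The point of `ℝⁿ` with `i`-th coordinate `t` and remaining coordinates `y`; for fixed `y` this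
runs through a line parallel to the `i`-th coordinate axis. -/
def linePoint {n : ℕ} (i : Fin n) (y : {j : Fin n // j ≠ i} → ℝ) (t : ℝ) :
    EuclideanSpace ℝ (Fin n) :=
  WithLp.toLp 2 fun j => if h : j = i then t else y ⟨j, h⟩

/-- `u` is absolutely continuous on lines: for each coordinate direction, on almost every line with
that direction (for the `(n-1)`-dimensional Lebesgue measure on the lines), `u` is absolutely
continuous on every compact segment of the line. -/
def IsACL {n : ℕ} (u : EuclideanSpace ℝ (Fin n) → ℝ) : Prop :=
  ∀ i : Fin n, ∀ᵐ y : ({j : Fin n // j ≠ i} → ℝ), ∀ a b : ℝ,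
    AbsolutelyContinuousOnInterval (fun t => u (linePoint i y t)) a b

/-- `|∇u(x)|`, through the partial derivatives of `u` (which exist almost everywhere when `u` is
absolutely continuous on lines). -/
def gradNorm {n : ℕ} (u : EuclideanSpace ℝ (Fin n) → ℝ) (x : EuclideanSpace ℝ (Fin n)) : ℝ :=
  Real.sqrt (∑ i : Fin n, (lineDeriv ℝ u x (EuclideanSpace.single i 1)) ^ 2)

/-- The class `W(O, K)` of admissible functions for the condenser `(O, K)`. -/
structure IsAdmissible {n : ℕ} (O K : Set (EuclideanSpace ℝ (Fin n)))
    (u : EuclideanSpace ℝ (Fin n) → ℝ) : Prop where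
  continuous : Continuous u
  acl : IsACL u
  nonneg : ∀ x, 0 ≤ u x
  le_one : ∀ x, u x ≤ 1
  eq_zero : ∀ x ∈ K, u x = 0
  isCompact_closure : IsCompact (closure {x | 0 ≤ u x ∧ u x < 1})
  closure_subset : closure {x | 0 ≤ u x ∧ u x < 1} ⊆ O

/-- The conformal capacity of the condenser `(O, K)`: the infimum of `∫ |∇u|ⁿ dV`, `u ∈ W(O, K)`. -/
def condCap {n : ℕ} (O K : Set (EuclideanSpace ℝ (Fin n))) : ℝ≥0∞ :=
  ⨅ (u : EuclideanSpace ℝ (Fin n) → ℝ) (_ : IsAdmissible O K u),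
    ∫⁻ x, ENNReal.ofReal (gradNorm u x ^ n)

/-- The conformal modulus `nmod(O, K) = (ncap(O, K) / σ_{n-1})^{1/(1-n)}`, in `[0, ∞]`. -/
def nmod {n : ℕ} (O K : Set (EuclideanSpace ℝ (Fin n))) : ℝ≥0∞ :=
  (condCap O K / ENNReal.ofReal (sphereArea (n - 1))) ^ (1 / (1 - (n : ℝ)))

/-- `nmod(rBⁿ, K) - ln r`. -/
def reducedMod {n : ℕ} (K : Set (EuclideanSpace ℝ (Fin n))) (r : ℝ) : EReal :=
  (nmod (Metric.ball 0 r) K : EReal) - (Real.log r : EReal)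

/-- `ncap₁(K) = exp (- lim_{r → ∞} (nmod(rBⁿ, K) - ln r))`. -/
def ncap1 {n : ℕ} (K : Set (EuclideanSpace ℝ (Fin n))) : ℝ≥0∞ :=
  EReal.exp (-(limUnder atTop (reducedMod K)))

/-! ### Logarithmic energy, the third capacity and the transfinite modulus -/

/-- The kernel `ln (1 / |x - y|)`, equal to `+∞` when `x = y`. -/
def logKernel {n : ℕ} (x y : EuclideanSpace ℝ (Fin n)) : EReal :=
  ENNReal.log (edist x y)⁻¹

/-- The double integral of the positive part of `ln (1 / |x - y|)` against `μ ⊗ ν`. -/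
def posEnergy {n : ℕ} (μ ν : Measure (EuclideanSpace ℝ (Fin n))) : ℝ≥0∞ :=
  ∫⁻ x, ∫⁻ y, (logKernel x y).toENNReal ∂ν ∂μ

/-- The double integral of the negative part of `ln (1 / |x - y|)` against `μ ⊗ ν`. -/
def negEnergy {n : ℕ} (μ ν : Measure (EuclideanSpace ℝ (Fin n))) : ℝ≥0∞ :=
  ∫⁻ x, ∫⁻ y, (-logKernel x y).toENNReal ∂ν ∂μ

/-- The logarithmic Robin mass: the infimum of `∬ ln (1 / |x - y|) dμ(x) dμ(y)` over the unit
measures `μ` carried by `K`. For compact `K` the negative part of the integrand is bounded, so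
that the integral is well defined in `(-∞, ∞]`. -/
def nrob {n : ℕ} (K : Set (EuclideanSpace ℝ (Fin n))) : EReal :=
  ⨅ (μ : Measure (EuclideanSpace ℝ (Fin n))) (_ : IsProbabilityMeasure μ) (_ : μ Kᶜ = 0),
    (posEnergy μ μ : EReal) - (negEnergy μ μ : EReal)

/-- `ncap₃(K) = exp (- nrob(K))`. -/
def ncap3 {n : ℕ} (K : Set (EuclideanSpace ℝ (Fin n))) : ℝ≥0∞ :=
  EReal.exp (-nrob K)

/-- The integral of the positive part of `ln (1 / |x - y|)` with respect to `ν ⊗ ν`, where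
`ν = νK - νO` and `νK`, `νO` are mutually singular. -/
def signedPos {n : ℕ} (νK νO : Measure (EuclideanSpace ℝ (Fin n))) : ℝ≥0∞ :=
  posEnergy νK νK + posEnergy νO νO + negEnergy νK νO + negEnergy νO νK

/-- The negative counterpart: the integral of `ln (1 / |x - y|)` with respect to `ν ⊗ ν` is
`signedPos νK νO - signedNeg νK νO`, whenever at least one of the two is finite. -/
def signedNeg {n : ℕ} (νK νO : Measure (EuclideanSpace ℝ (Fin n))) : ℝ≥0∞ :=
  negEnergy νK νK + negEnergy νO νO + posEnergy νK νO + posEnergy νO νK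

/-- The class of charges `ν = νK - νO` of the condenser `(O, K)`: `νK` and `νO` are unit measures
carried by the two plates `K` and `ℝⁿ \ O`, and the energy integral of `ν` has a meaning. -/
structure IsCharge {n : ℕ} (O K : Set (EuclideanSpace ℝ (Fin n)))
    (νK νO : Measure (EuclideanSpace ℝ (Fin n))) : Prop where
  prob_inner : IsProbabilityMeasure νK
  prob_outer : IsProbabilityMeasure νO
  carried_inner : νK Kᶜ = 0
  carried_outer : νO O = 0
  defined : signedPos νK νO ≠ ⊤ ∨ signedNeg νK νO ≠ ⊤

/-- The transfinite modulus `nmd(O, K)`: the infimum of `∬ ln (1 / |x - y|) dν(x) dν(y)`. -/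
def nmd {n : ℕ} (O K : Set (EuclideanSpace ℝ (Fin n))) : EReal :=
  ⨅ (νK : Measure (EuclideanSpace ℝ (Fin n))) (νO : Measure (EuclideanSpace ℝ (Fin n)))
    (_ : IsCharge O K νK νO),
    (signedPos νK νO : EReal) - (signedNeg νK νO : EReal)

end

end ConformalCapacity

/-!
The logarithmic kernel is, up to an additive constant, a superposition of Gaussians (Frullani),
hence positive definite on differences of probability measures. As the uniform measure of the unit
sphere has constant potential on the sphere and no smaller one inside, it minimizes the energy among
all unit measures carried by the ball.

Part (i): for a charge `νK - νO` of the condenser `(rB, K)`, the mutual energy of `νK` and `νO` is,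
up to `o(1)`, minus the logarithmic moment of `νO`. This moment is absorbed by an inversion, which
turns `νO` into a measure carried by a small ball, whose energy is at least that of the uniform
measure of its boundary sphere. So the infimum decouples: `nmd (rB, K) - ln r` tends to the sum of
the Robin constants of `K` and of the unit ball.

Part (ii): the potential of the uniform measure of a sphere is a logarithmic sine integral. The
capacity of a spherical ring is bounded below by integrating `∇u` against the divergence-free field
`x / |x|ⁿ` and applying Hölder's inequality, with equality for the logarithm of `|x|`. The two
capacities of a ball agree exactly when the logarithmic sine integral vanishes, which happens only
in the plane.
-/

namespace ConformalCapacity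

open Set Metric

/-! ### The uniform measure on the unit sphere -/

section PolarCoordinates

theorem lintegral_fun_norm_addHaar {E : Type*} [NormedAddCommGroup E] [NormedSpace ℝ E]
    [MeasurableSpace E] [BorelSpace E] [FiniteDimensional ℝ E] [Nontrivial E] (μ : Measure E)
    [μ.IsAddHaarMeasure] {f : ℝ → ℝ≥0∞} (hf : Measurable f) :
    ∫⁻ x, f ‖x‖ ∂μ = Module.finrank ℝ E * μ (ball 0 1) *
      ∫⁻ y in Ioi (0 : ℝ), ENNReal.ofReal (y ^ (Module.finrank ℝ E - 1)) * f y := by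
  calc
    ∫⁻ x, f ‖x‖ ∂μ = ∫⁻ x : ({(0)}ᶜ : Set E), f ‖x.1‖ ∂(μ.comap (↑)) := by
      rw [lintegral_subtype_comap (measurableSet_singleton _).compl fun x ↦ f ‖x‖,
        restrict_compl_singleton]
    _ = ∫⁻ x, f x.2 ∂μ.toSphere.prod (.volumeIoiPow (Module.finrank ℝ E - 1)) := by
      simpa using μ.measurePreserving_homeomorphUnitSphereProd.lintegral_comp_emb
        (Homeomorph.measurableEmbedding _) (f ∘ Subtype.val ∘ Prod.snd)
    _ = μ.toSphere univ *
        ∫⁻ x : Ioi (0 : ℝ), f x ∂.volumeIoiPow (Module.finrank ℝ E - 1) := by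
      rw [lintegral_prod _ (by fun_prop)]
      simp [mul_comm]
    _ = _ := by
      rw [μ.toSphere_apply_univ, Measure.volumeIoiPow,
        lintegral_withDensity_eq_lintegral_mul _ (by fun_prop) (by fun_prop)]
      congr 1
      exact lintegral_subtype_comap measurableSet_Ioi
        (fun y : ℝ ↦ ENNReal.ofReal (y ^ (Module.finrank ℝ E - 1)) * f y)

theorem lintegral_upperHalfPlane_eq_polar {G : ℝ → ℝ → ℝ≥0∞}
    (hG : Measurable (Function.uncurry G)) :
    ∫⁻ t, ∫⁻ τ in Ioi (0 : ℝ), G t τ =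
      ∫⁻ s in Ioi (0 : ℝ), ∫⁻ θ in Ioo 0 Real.pi,
        ENNReal.ofReal s * G (s * Real.cos θ) (s * Real.sin θ) := by
  set H : ℝ × ℝ → ℝ≥0∞ := (Prod.snd ⁻¹' Ioi 0).indicator (Function.uncurry G) with H_def
  have hH : Measurable H := hG.indicator (measurable_snd measurableSet_Ioi)
  have lintegral_H_right (t : ℝ) : ∫⁻ τ, H (t, τ) = ∫⁻ τ in Ioi (0 : ℝ), G t τ := by
    rw [← lintegral_indicator measurableSet_Ioi]
    rfl
  have H_polar {s : ℝ} (hs : 0 < s) : ∀ θ ∈ Ioo (-Real.pi) Real.pi,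
      ENNReal.ofReal s • H (polarCoord.symm (s, θ)) = (Ioo 0 Real.pi).indicator
        (fun θ ↦ ENNReal.ofReal s * G (s * Real.cos θ) (s * Real.sin θ)) θ := by
    intro θ hθ
    rcases le_or_gt θ 0 with hθ0 | hθ0
    · have : ¬ 0 < s * Real.sin θ := by
        have := Real.sin_nonpos_of_nonpos_of_neg_pi_le hθ0 hθ.1.le
        nlinarith
      simp [H_def, indicator, this, hθ0.not_gt]
    · have : 0 < s * Real.sin θ := mul_pos hs (Real.sin_pos_of_pos_of_lt_pi hθ0 hθ.2)
      simp [H_def, indicator, this, hθ0, hθ.2]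
  have hsub : Ioo 0 Real.pi ⊆ Ioo (-Real.pi) Real.pi :=
    Ioo_subset_Ioo_left (by linarith [Real.pi_pos])
  simp_rw [← lintegral_H_right]
  rw [← lintegral_prod _ hH.aemeasurable, ← Measure.volume_eq_prod,
    ← lintegral_comp_polarCoord_symm, polarCoord_target, Measure.volume_eq_prod,
    ← Measure.prod_restrict, lintegral_prod]
  · refine setLIntegral_congr_fun measurableSet_Ioi fun s hs ↦ ?_
    rw [setLIntegral_congr_fun measurableSet_Ioo (H_polar hs),
      setLIntegral_indicator measurableSet_Ioo, inter_eq_left.2 hsub]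
  · simp only [smul_eq_mul]
    exact ((by fun_prop : Measurable fun p : ℝ × ℝ ↦ ENNReal.ofReal p.1).mul
      (hH.comp continuous_polarCoord_symm.measurable)).aemeasurable

theorem norm_toLp_cons {m : ℕ} (t : ℝ) (z : Fin m → ℝ) :
    ‖WithLp.toLp 2 (Fin.cons t z : Fin (m + 1) → ℝ)‖ =
      √(t ^ 2 + ‖WithLp.toLp 2 z‖ ^ 2) := by
  rw [EuclideanSpace.norm_eq, EuclideanSpace.norm_eq, Real.sq_sqrt (by positivity)]
  simp [Fin.sum_univ_succ]

theorem lintegral_toLp {m : ℕ} (f : EuclideanSpace ℝ (Fin m) → ℝ≥0∞) :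
    ∫⁻ z : Fin m → ℝ, f (WithLp.toLp 2 z) = ∫⁻ x, f x :=
  (EuclideanSpace.volume_preserving_symm_measurableEquiv_toLp
    (Fin m)).symm.lintegral_comp_emb (MeasurableEquiv.measurableEmbedding _) f

theorem lintegral_norm_apply_zero (m : ℕ) {F : ℝ → ℝ → ℝ≥0∞}
    (hF : Measurable (Function.uncurry F)) :
    ∫⁻ x : EuclideanSpace ℝ (Fin (m + 1)), F ‖x‖ (x 0) =
      ∫⁻ t : ℝ, ∫⁻ z : EuclideanSpace ℝ (Fin m), F (√(t ^ 2 + ‖z‖ ^ 2)) t := by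
  have piFinSuccAbove_symm (a : ℝ × (Fin m → ℝ)) :
      (MeasurableEquiv.piFinSuccAbove (fun _ : Fin (m + 1) ↦ ℝ) 0).symm a =
        (Fin.cons a.1 a.2 : Fin (m + 1) → ℝ) := by
    simp; rfl
  have hslice := (volume_preserving_piFinSuccAbove
    (fun _ : Fin (m + 1) ↦ ℝ) 0).symm.lintegral_comp_emb (MeasurableEquiv.measurableEmbedding _)
      (fun x : Fin (m + 1) → ℝ ↦ F ‖WithLp.toLp 2 x‖ (x 0))
  simp only [piFinSuccAbove_symm, norm_toLp_cons, Fin.cons_zero] at hslice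
  rw [← lintegral_toLp]
  refine hslice.symm.trans ?_
  rw [Measure.volume_eq_prod, lintegral_prod]
  · exact lintegral_congr fun t ↦ lintegral_toLp fun z ↦ F (√(t ^ 2 + ‖z‖ ^ 2)) t
  · exact (hF.comp (by fun_prop : Measurable fun p : ℝ × (Fin m → ℝ) ↦
      (√(p.1 ^ 2 + ‖WithLp.toLp 2 p.2‖ ^ 2), p.1))).aemeasurable

theorem lintegral_norm_apply_zero_eq_polar (m : ℕ) {F : ℝ → ℝ → ℝ≥0∞}
    (hF : Measurable (Function.uncurry F)) :
    ∫⁻ x : EuclideanSpace ℝ (Fin (m + 2)), F ‖x‖ (x 0) =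
      (m + 1) * volume (ball (0 : EuclideanSpace ℝ (Fin (m + 1))) 1) *
        ∫⁻ s in Ioi (0 : ℝ), ∫⁻ θ in Ioo 0 Real.pi,
          ENNReal.ofReal s * (ENNReal.ofReal ((s * Real.sin θ) ^ m) * F s (s * Real.cos θ)) := by
  have hG : Measurable fun p : ℝ × ℝ ↦ ENNReal.ofReal (p.2 ^ m) * F (√(p.1 ^ 2 + p.2 ^ 2)) p.1 :=
    (by fun_prop : Measurable fun p : ℝ × ℝ ↦ ENNReal.ofReal (p.2 ^ m)).mul
      (hF.comp (by fun_prop : Measurable fun p : ℝ × ℝ ↦ (√(p.1 ^ 2 + p.2 ^ 2), p.1)))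
  have hradial (t : ℝ) : ∫⁻ z : EuclideanSpace ℝ (Fin (m + 1)), F (√(t ^ 2 + ‖z‖ ^ 2)) t =
      (m + 1) * volume (ball (0 : EuclideanSpace ℝ (Fin (m + 1))) 1) *
        ∫⁻ τ in Ioi (0 : ℝ), ENNReal.ofReal (τ ^ m) * F (√(t ^ 2 + τ ^ 2)) t := by
    rw [lintegral_fun_norm_addHaar volume (f := fun τ ↦ F (√(t ^ 2 + τ ^ 2)) t)
      (hF.comp (by fun_prop : Measurable fun τ : ℝ ↦ (√(t ^ 2 + τ ^ 2), t)))]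
    simp
  rw [lintegral_norm_apply_zero _ hF, lintegral_congr hradial,
    lintegral_const_mul _ (Measurable.lintegral_prod_right hG),
    lintegral_upperHalfPlane_eq_polar
      (G := fun t τ ↦ ENNReal.ofReal (τ ^ m) * F (√(t ^ 2 + τ ^ 2)) t) hG]
  congr 1
  refine setLIntegral_congr_fun measurableSet_Ioi fun s (hs : 0 < s) ↦
    lintegral_congr fun θ ↦ ?_
  rw [show (s * Real.cos θ) ^ 2 + (s * Real.sin θ) ^ 2 = s ^ 2 by
    linear_combination s ^ 2 * Real.sin_sq_add_cos_sq θ, Real.sqrt_sq hs.le]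

end PolarCoordinates

section UnitSphereMeasure

variable {n : ℕ}

/-- The uniform probability measure on the unit sphere, encoded as the image of the uniform
probability measure of the unit ball under the radial projection `x ↦ x / ‖x‖`. -/
noncomputable def unitSphereMeasure (n : ℕ) : Measure (EuclideanSpace ℝ (Fin n)) :=
  (ProbabilityTheory.cond volume (ball (0 : EuclideanSpace ℝ (Fin n)) 1)).map
    fun x ↦ ‖x‖⁻¹ • x

theorem measurable_radialProjection :
    Measurable fun x : EuclideanSpace ℝ (Fin n) ↦ ‖x‖⁻¹ • x := by fun_prop

theorem lintegral_unitSphereMeasure {f : EuclideanSpace ℝ (Fin n) → ℝ≥0∞} (hf : Measurable f) :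
    ∫⁻ y, f y ∂unitSphereMeasure n =
      (volume (ball (0 : EuclideanSpace ℝ (Fin n)) 1))⁻¹ *
        ∫⁻ x in ball (0 : EuclideanSpace ℝ (Fin n)) 1, f (‖x‖⁻¹ • x) := by
  rw [unitSphereMeasure, lintegral_map hf measurable_radialProjection, ProbabilityTheory.cond,
    lintegral_smul_measure, smul_eq_mul]

instance (n : ℕ) : IsProbabilityMeasure (unitSphereMeasure n) := by
  have := ProbabilityTheory.cond_isProbabilityMeasure_of_finite (μ := volume)
    (measure_ball_pos volume (0 : EuclideanSpace ℝ (Fin n)) one_pos).ne' measure_ball_lt_top.ne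
  exact Measure.isProbabilityMeasure_map measurable_radialProjection.aemeasurable

theorem ae_norm_eq_one_unitSphereMeasure (hn : n ≠ 0) :
    ∀ᵐ y ∂unitSphereMeasure n, ‖y‖ = 1 := by
  have : NeZero n := ⟨hn⟩
  rw [unitSphereMeasure, ae_map_iff measurable_radialProjection.aemeasurable
    (measurableSet_eq_fun (by fun_prop) (by fun_prop))]
  refine ProbabilityTheory.cond_absolutelyContinuous.ae_le ?_
  filter_upwards [Measure.ae_ne volume 0] with x hx
  simp [norm_smul, hx]

theorem lintegral_unitSphereMeasure_comp_isometry
    (e : EuclideanSpace ℝ (Fin n) ≃ₗᵢ[ℝ] EuclideanSpace ℝ (Fin n))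
    {f : EuclideanSpace ℝ (Fin n) → ℝ≥0∞} (hf : Measurable f) :
    ∫⁻ y, f (e y) ∂unitSphereMeasure n = ∫⁻ y, f y ∂unitSphereMeasure n := by
  rw [lintegral_unitSphereMeasure hf,
    lintegral_unitSphereMeasure (f := fun y ↦ f (e y)) (hf.comp e.continuous.measurable),
    ← lintegral_indicator measurableSet_ball, ← lintegral_indicator measurableSet_ball,
    ← e.measurePreserving.lintegral_comp_emb e.toMeasurableEquiv.measurableEmbedding
      ((ball 0 1).indicator fun x ↦ f (‖x‖⁻¹ • x))]
  congr 1
  refine lintegral_congr fun x ↦ ?_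
  simp [indicator]

/-- The normalizing constant of the density `(sin θ)^m` on `(0, π)`, which is the law of the polar
angle under `unitSphereMeasure (m + 2)`. -/
noncomputable def sinPowConst (m : ℕ) : ℝ := (∫ θ in (0 : ℝ)..Real.pi, Real.sin θ ^ m)⁻¹

theorem sinPowConst_pos (m : ℕ) : 0 < sinPowConst m := inv_pos.2 (integral_sin_pow_pos m)

theorem lintegral_sin_pow (m : ℕ) :
    ∫⁻ θ in Ioo 0 Real.pi, ENNReal.ofReal (Real.sin θ ^ m) =
      ENNReal.ofReal (∫ θ in (0 : ℝ)..Real.pi, Real.sin θ ^ m) := by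
  rw [intervalIntegral.integral_of_le Real.pi_pos.le, integral_Ioc_eq_integral_Ioo,
    ofReal_integral_eq_lintegral_ofReal]
  · exact (Continuous.integrableOn_Icc (by fun_prop)).mono_set Ioo_subset_Icc_self
  · filter_upwards [ae_restrict_mem measurableSet_Ioo] with θ hθ
    exact pow_nonneg (Real.sin_pos_of_pos_of_lt_pi hθ.1 hθ.2).le _

theorem exists_lintegral_unitSphereMeasure_apply_zero_eq_mul (m : ℕ) :
    ∃ C : ℝ≥0∞, ∀ g : ℝ → ℝ≥0∞, Measurable g →
      ∫⁻ y, g (y 0) ∂unitSphereMeasure (m + 2) =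
        C * ∫⁻ θ in Ioo 0 Real.pi, ENNReal.ofReal (Real.sin θ ^ m) * g (Real.cos θ) := by
  refine ⟨(volume (ball (0 : EuclideanSpace ℝ (Fin (m + 2))) 1))⁻¹ *
    ((m + 1) * volume (ball (0 : EuclideanSpace ℝ (Fin (m + 1))) 1) *
      ∫⁻ s in Ioi (0 : ℝ), (Iio (1 : ℝ)).indicator (fun s ↦ ENNReal.ofReal (s ^ (m + 1))) s),
    fun g hg ↦ ?_⟩
  have hF : Measurable (Function.uncurry fun s t : ℝ ↦
      (Iio (1 : ℝ)).indicator (fun _ ↦ g (s⁻¹ * t)) s) :=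
    (hg.comp (by fun_prop : Measurable fun p : ℝ × ℝ ↦ p.1⁻¹ * p.2)).indicator
      (measurable_fst measurableSet_Iio)
  have indicator_ball (x : EuclideanSpace ℝ (Fin (m + 2))) :
      (ball 0 1).indicator (fun x ↦ g ((‖x‖⁻¹ • x) 0)) x =
        (Iio (1 : ℝ)).indicator (fun _ ↦ g (‖x‖⁻¹ * x 0)) ‖x‖ := by
    simp [indicator]
  rw [lintegral_unitSphereMeasure (f := fun y ↦ g (y 0)) (by fun_prop),
    ← lintegral_indicator measurableSet_ball, lintegral_congr indicator_ball,
    lintegral_norm_apply_zero_eq_polar m hF, 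
    mul_assoc (volume (ball (0 : EuclideanSpace ℝ (Fin (m + 2))) 1))⁻¹,
    mul_assoc ((m + 1) * volume (ball (0 : EuclideanSpace ℝ (Fin (m + 1))) 1)),
    ← lintegral_mul_const _ (Measurable.indicator (by fun_prop) measurableSet_Iio)]
  congr 2
  refine setLIntegral_congr_fun measurableSet_Ioi fun s (hs : 0 < s) ↦ ?_
  rw [← lintegral_const_mul _ (by fun_prop)]
  refine lintegral_congr fun θ ↦ ?_
  by_cases hs1 : s < 1
  · simp only [indicator, mem_Iio, hs1, if_true]
    rw [inv_mul_cancel_left₀ hs.ne', mul_pow, ENNReal.ofReal_mul (by positivity), pow_succ',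
      ENNReal.ofReal_mul hs.le]
    ring
  · simp [indicator, hs1]

theorem lintegral_unitSphereMeasure_apply_zero (m : ℕ) {g : ℝ → ℝ≥0∞} (hg : Measurable g) :
    ∫⁻ y, g (y 0) ∂unitSphereMeasure (m + 2) = ENNReal.ofReal (sinPowConst m) *
      ∫⁻ θ in Ioo 0 Real.pi, ENNReal.ofReal (Real.sin θ ^ m) * g (Real.cos θ) := by
  obtain ⟨C, hC⟩ := exists_lintegral_unitSphereMeasure_apply_zero_eq_mul m
  have hmass := hC 1 measurable_one
  simp only [Pi.one_apply, lintegral_one, measure_univ, mul_one, lintegral_sin_pow] at hmass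
  rw [hC g hg, sinPowConst, ENNReal.ofReal_inv_of_pos (integral_sin_pow_pos m),
    ← ENNReal.eq_inv_of_mul_eq_one_left hmass.symm]

end UnitSphereMeasure

/-! ### Logarithmic sine integrals -/

section LogSine

variable {ρ θ a : ℝ}

/-- `ln |e^{iθ} - ρ|²`, the logarithm of the squared distance from a point at distance `|ρ|` from
the origin to the point of the unit sphere at polar angle `θ` from it. -/
noncomputable def logSqDist (ρ θ : ℝ) : ℝ := Real.log (1 + ρ ^ 2 - 2 * ρ * Real.cos θ)

/-- `∫_0^π (sin θ)^m ln (1 + ρ² - 2 ρ cos θ) dθ`: up to normalization, the logarithmic potential of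
the uniform measure of the unit sphere of `ℝ^{m+2}` at distance `ρ` from the origin. -/
noncomputable def logSineIntegral (m : ℕ) (ρ : ℝ) : ℝ :=
  ∫ θ in (0 : ℝ)..Real.pi, Real.sin θ ^ m * logSqDist ρ θ

theorem logSqDist_eq_two_mul_log_norm (ρ θ : ℝ) :
    logSqDist ρ θ = 2 * Real.log ‖circleMap 0 1 θ - ρ‖ := by
  have norm_sq : 1 + ρ ^ 2 - 2 * ρ * Real.cos θ = ‖circleMap 0 1 θ - ρ‖ ^ 2 := by
    rw [← Complex.normSq_eq_norm_sq, Complex.normSq_apply]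
    simp only [circleMap, Complex.ofReal_one, one_mul, zero_add, Complex.sub_re, Complex.sub_im,
      Complex.exp_ofReal_mul_I_re, Complex.exp_ofReal_mul_I_im, Complex.ofReal_re,
      Complex.ofReal_im]
    linear_combination -Real.sin_sq_add_cos_sq θ
  rw [logSqDist, norm_sq, Real.log_pow, Nat.cast_ofNat]

theorem intervalIntegrable_logSqDist (ρ : ℝ) :
    IntervalIntegrable (logSqDist ρ) volume 0 (2 * Real.pi) := by
  have h : CircleIntegrable (fun z : ℂ ↦ Real.log ‖z - ρ‖) 0 1 :=
    circleIntegrable_log_norm_sub_const 1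
  simpa only [← logSqDist_eq_two_mul_log_norm] using IntervalIntegrable.const_mul h 2

theorem intervalIntegrable_sin_pow_mul_logSqDist (m : ℕ) (ρ : ℝ) :
    IntervalIntegrable (fun θ ↦ Real.sin θ ^ m * logSqDist ρ θ) volume 0 Real.pi :=
  ((intervalIntegrable_logSqDist ρ).mono_set (by
    rw [uIcc_of_le Real.pi_pos.le, uIcc_of_le (by positivity)]
    exact Icc_subset_Icc_right (by linarith [Real.pi_pos]))).continuousOn_mul (by fun_prop)

theorem integral_logSqDist_zero_two_pi (hρ : |ρ| ≤ 1) :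
    ∫ θ in (0 : ℝ)..2 * Real.pi, logSqDist ρ θ = 0 := by
  have hjensen := circleAverage_log_norm_sub_const_eq_posLog (a := (ρ : ℂ))
  rw [(Real.posLog_eq_zero_iff _).2 (by simpa using hρ), Real.circleAverage, smul_eq_mul,
    mul_eq_zero] at hjensen
  simp only [logSqDist_eq_two_mul_log_norm, intervalIntegral.integral_const_mul,
    hjensen.resolve_left (by positivity), mul_zero]

theorem integral_logSqDist_pi_two_pi (ρ : ℝ) :
    ∫ θ in Real.pi..2 * Real.pi, logSqDist ρ θ = ∫ θ in (0 : ℝ)..Real.pi, logSqDist ρ θ := by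
  have hreflect := intervalIntegral.integral_comp_sub_left (a := 0) (b := Real.pi)
    (logSqDist ρ) (2 * Real.pi)
  simp only [logSqDist, Real.cos_two_pi_sub, sub_zero] at hreflect
  rw [show 2 * Real.pi - Real.pi = Real.pi by ring] at hreflect
  exact hreflect.symm

theorem logSineIntegral_zero_left (hρ : |ρ| ≤ 1) : logSineIntegral 0 ρ = 0 := by
  have hint {a b : ℝ} (ha : a ∈ Icc 0 (2 * Real.pi)) (hb : b ∈ Icc 0 (2 * Real.pi)) :
      IntervalIntegrable (logSqDist ρ) volume a b :=
    (intervalIntegrable_logSqDist ρ).mono_set (by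
      rw [uIcc_of_le (a := 0) (by positivity)]
      exact uIcc_subset_Icc ha hb)
  have hpi : Real.pi ∈ Icc 0 (2 * Real.pi) := ⟨by positivity, by linarith [Real.pi_pos]⟩
  have hsplit := intervalIntegral.integral_add_adjacent_intervals
    (hint ⟨le_rfl, by positivity⟩ hpi) (hint hpi ⟨by positivity, le_rfl⟩)
  rw [integral_logSqDist_pi_two_pi, integral_logSqDist_zero_two_pi hρ] at hsplit
  simp only [logSineIntegral, pow_zero, one_mul]
  linarith

theorem logSineIntegral_zero_right (m : ℕ) : logSineIntegral m 0 = 0 := by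
  simp [logSineIntegral, logSqDist]

theorem logSineIntegral_neg (m : ℕ) (ρ : ℝ) : logSineIntegral m (-ρ) = logSineIntegral m ρ := by
  have hreflect := intervalIntegral.integral_comp_sub_left (a := 0) (b := Real.pi)
    (fun θ ↦ Real.sin θ ^ m * logSqDist ρ θ) Real.pi
  simp only [logSqDist, Real.sin_pi_sub, Real.cos_pi_sub, sub_self, sub_zero] at hreflect
  simpa only [logSineIntegral, logSqDist, neg_sq, mul_neg, neg_mul] using hreflect

/-- The integrand of `2 * (logSineIntegral m 1 - logSineIntegral m ρ)` without the factor
`(sin θ)^m`, symmetrized under `θ ↦ π - θ` so that it becomes a function of `sin θ`. -/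
noncomputable def logSineGap (ρ θ : ℝ) : ℝ :=
  (logSqDist 1 θ + logSqDist (-1) θ) - (logSqDist ρ θ + logSqDist (-ρ) θ)

theorem intervalIntegrable_sin_pow_mul_logSineGap (m : ℕ) (ρ : ℝ) :
    IntervalIntegrable (fun θ ↦ Real.sin θ ^ m * logSineGap ρ θ) volume 0 Real.pi := by
  have hint := intervalIntegrable_sin_pow_mul_logSqDist m
  simp only [logSineGap, mul_sub, mul_add]
  exact ((hint _).add (hint _)).sub ((hint _).add (hint _))

theorem intervalIntegrable_logSineGap (ρ : ℝ) :
    IntervalIntegrable (logSineGap ρ) volume 0 Real.pi := by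
  simpa only [pow_zero, one_mul] using intervalIntegrable_sin_pow_mul_logSineGap 0 ρ

theorem integral_sin_pow_mul_logSineGap (m : ℕ) (ρ : ℝ) :
    ∫ θ in (0 : ℝ)..Real.pi, Real.sin θ ^ m * logSineGap ρ θ =
      2 * (logSineIntegral m 1 - logSineIntegral m ρ) := by
  have hint := intervalIntegrable_sin_pow_mul_logSqDist m
  calc
    _ = logSineIntegral m 1 + logSineIntegral m (-1) -
        (logSineIntegral m ρ + logSineIntegral m (-ρ)) := by
      simp only [logSineGap, mul_sub, mul_add, logSineIntegral]
      rw [intervalIntegral.integral_sub ((hint _).add (hint _)) ((hint _).add (hint _)),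
        intervalIntegral.integral_add (hint _) (hint _),
        intervalIntegral.integral_add (hint _) (hint _)]
    _ = _ := by
      rw [logSineIntegral_neg, logSineIntegral_neg]
      ring

-- For `m = 0` both integrals vanish (Jensen's formula), so a constant may be subtracted from the
-- weight; with a suitable one the integrand has a constant sign.
theorem integral_sin_pow_sub_mul_logSineGap (m : ℕ) (hρ : |ρ| ≤ 1) (c : ℝ) :
    ∫ θ in (0 : ℝ)..Real.pi, (Real.sin θ ^ m - c) * logSineGap ρ θ =
      2 * (logSineIntegral m 1 - logSineIntegral m ρ) := by
  have hzero : ∫ θ in (0 : ℝ)..Real.pi, logSineGap ρ θ = 0 := by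
    simpa [logSineIntegral_zero_left hρ, logSineIntegral_zero_left (ρ := 1)]
      using integral_sin_pow_mul_logSineGap 0 ρ
  simp only [sub_mul]
  rw [intervalIntegral.integral_sub (intervalIntegrable_sin_pow_mul_logSineGap m ρ)
    ((intervalIntegrable_logSineGap ρ).const_mul c), intervalIntegral.integral_const_mul, hzero,
    integral_sin_pow_mul_logSineGap, mul_zero, sub_zero]

theorem logSqDist_arg_pos (hθ : θ ∈ Ioo 0 Real.pi) (ρ : ℝ) :
    0 < 1 + ρ ^ 2 - 2 * ρ * Real.cos θ := by
  nlinarith [sq_nonneg (ρ - Real.cos θ), pow_pos (Real.sin_pos_of_pos_of_lt_pi hθ.1 hθ.2) 2,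
    Real.sin_sq_add_cos_sq θ]

theorem logSqDist_add_logSqDist_neg (hθ : θ ∈ Ioo 0 Real.pi) (ρ : ℝ) :
    logSqDist ρ θ + logSqDist (-ρ) θ =
      Real.log ((1 - ρ ^ 2) ^ 2 + 4 * ρ ^ 2 * Real.sin θ ^ 2) := by
  rw [logSqDist, logSqDist, ← Real.log_mul (logSqDist_arg_pos hθ ρ).ne'
    (logSqDist_arg_pos hθ (-ρ)).ne', Real.sin_sq]
  congr 1
  ring

theorem logSineGap_eq (hθ : θ ∈ Ioo 0 Real.pi) :
    logSineGap ρ θ = Real.log (4 * Real.sin θ ^ 2) -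
      Real.log ((1 - ρ ^ 2) ^ 2 + 4 * ρ ^ 2 * Real.sin θ ^ 2) := by
  rw [logSineGap, logSqDist_add_logSqDist_neg hθ, logSqDist_add_logSqDist_neg hθ]
  norm_num

-- `logSineGap ρ θ` has the sign of `4 (1 - ρ²) (sin θ)² - (1 - ρ²)²`, hence that of `sin θ - a`.
theorem sin_pow_sub_pow_mul_logSineGap_nonneg (m : ℕ) (ha : 0 ≤ a) (haρ : 4 * a ^ 2 = 1 - ρ ^ 2)
    (hθ : θ ∈ Ioo 0 Real.pi) : 0 ≤ (Real.sin θ ^ m - a ^ m) * logSineGap ρ θ := by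
  have hsin := Real.sin_pos_of_pos_of_lt_pi hθ.1 hθ.2
  rw [logSineGap_eq hθ]
  rcases le_total a (Real.sin θ) with h | h
  · have hsq : a ^ 2 ≤ Real.sin θ ^ 2 := pow_le_pow_left₀ ha h 2
    have hpos : 0 < (1 - ρ ^ 2) ^ 2 + 4 * ρ ^ 2 * Real.sin θ ^ 2 := by
      rcases eq_or_ne ρ 0 with rfl | hρ
      · norm_num
      · positivity
    exact mul_nonneg (sub_nonneg.2 (pow_le_pow_left₀ ha h m))
      (sub_nonneg.2 (Real.log_le_log hpos (by nlinarith)))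
  · have hsq : Real.sin θ ^ 2 ≤ a ^ 2 := pow_le_pow_left₀ hsin.le h 2
    exact mul_nonneg_of_nonpos_of_nonpos (sub_nonpos.2 (pow_le_pow_left₀ hsin.le h m))
      (sub_nonpos.2 (Real.log_le_log (by positivity) (by nlinarith)))

theorem logSineIntegral_le_one (m : ℕ) (hρ : |ρ| ≤ 1) :
    logSineIntegral m ρ ≤ logSineIntegral m 1 := by
  have ha : 4 * (√(1 - ρ ^ 2) / 2) ^ 2 = 1 - ρ ^ 2 := by
    rw [div_pow, Real.sq_sqrt (sub_nonneg.2 ((sq_le_one_iff_abs_le_one ρ).2 hρ))]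
    ring
  have hnonneg : 0 ≤ ∫ θ in (0 : ℝ)..Real.pi,
      (Real.sin θ ^ m - (√(1 - ρ ^ 2) / 2) ^ m) * logSineGap ρ θ := by
    rw [intervalIntegral.integral_of_le Real.pi_pos.le, integral_Ioc_eq_integral_Ioo]
    exact setIntegral_nonneg measurableSet_Ioo fun θ hθ ↦
      sin_pow_sub_pow_mul_logSineGap_nonneg m (by positivity) ha hθ
  rw [integral_sin_pow_sub_mul_logSineGap m hρ] at hnonneg
  linarith

theorem sin_pow_sub_pow_mul_logSineGap_pos {m : ℕ} (hm : m ≠ 0)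
    (hθ : θ ∈ Ioo (Real.pi / 6) (Real.pi / 2)) :
    0 < (Real.sin θ ^ m - (1 / 2) ^ m) * logSineGap 0 θ := by
  have hpi := Real.pi_pos
  have hsin : 1 / 2 < Real.sin θ := by
    rw [← Real.sin_pi_div_six]
    exact Real.sin_lt_sin_of_lt_of_le_pi_div_two (by linarith) hθ.2.le hθ.1
  have hθ' : θ ∈ Ioo 0 Real.pi := ⟨by linarith [hθ.1], by linarith [hθ.2]⟩
  have hgap : logSineGap 0 θ = Real.log (4 * Real.sin θ ^ 2) := by simp [logSineGap_eq hθ']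
  rw [hgap]
  exact mul_pos (sub_pos.2 (pow_lt_pow_left₀ hsin (by norm_num) hm))
    (Real.log_pos (by nlinarith))

theorem logSineIntegral_one_pos {m : ℕ} (hm : m ≠ 0) : 0 < logSineIntegral m 1 := by
  have hpos : 0 < ∫ θ in (0 : ℝ)..Real.pi, (Real.sin θ ^ m - (1 / 2) ^ m) * logSineGap 0 θ := by
    rw [intervalIntegral.integral_of_le Real.pi_pos.le, integral_Ioc_eq_integral_Ioo,
      setIntegral_pos_iff_support_of_nonneg_ae]
    · have hsupport : Ioo (Real.pi / 6) (Real.pi / 2) ⊆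
          Function.support (fun θ ↦ (Real.sin θ ^ m - (1 / 2) ^ m) * logSineGap 0 θ) ∩
            Ioo 0 Real.pi := fun θ hθ ↦
        ⟨(sin_pow_sub_pow_mul_logSineGap_pos hm hθ).ne',
          by linarith [hθ.1, Real.pi_pos], by linarith [hθ.2, Real.pi_pos]⟩
      refine lt_of_lt_of_le ?_ (measure_mono hsupport)
      rw [Real.volume_Ioo]
      exact ENNReal.ofReal_pos.2 (by linarith [Real.pi_pos])
    · filter_upwards [ae_restrict_mem measurableSet_Ioo] with θ hθ
      exact sin_pow_sub_pow_mul_logSineGap_nonneg m (by norm_num) (by norm_num) hθ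
    · exact (intervalIntegrable_iff_integrableOn_Ioo_of_le Real.pi_pos.le).1
        ((intervalIntegrable_logSineGap 0).continuousOn_mul (by fun_prop))
  rw [integral_sin_pow_sub_mul_logSineGap m (by simp), logSineIntegral_zero_right] at hpos
  linarith

theorem integral_sin_pow_eq_Gamma (k : ℕ) : ∫ θ in (0 : ℝ)..Real.pi, Real.sin θ ^ k =
    √Real.pi * Real.Gamma (((k : ℝ) + 1) / 2) / Real.Gamma (((k : ℝ) + 2) / 2) := by
  induction k using Nat.twoStepInduction with
  | zero =>
    have hΓ : Real.Gamma 2⁻¹ = √Real.pi := by rw [← Real.Gamma_one_half_eq, one_div]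
    simp [hΓ, Real.mul_self_sqrt Real.pi_pos.le]
  | one =>
    have hΓ : Real.Gamma (3 / 2) = √Real.pi / 2 := by
      rw [show (3 / 2 : ℝ) = 1 / 2 + 1 by norm_num, Real.Gamma_add_one (by norm_num),
        Real.Gamma_one_half_eq]
      ring
    norm_num [hΓ]
    field_simp
  | more k ih _ =>
    have Gamma_step {x : ℝ} (hx : 0 < x) :
        Real.Gamma ((x + 2) / 2) = x / 2 * Real.Gamma (x / 2) := by
      rw [← Real.Gamma_add_one (by positivity)]
      ring_nf
    have hΓ : Real.Gamma (((k : ℝ) + 2) / 2) ≠ 0 := (Real.Gamma_pos_of_pos (by positivity)).ne'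
    rw [integral_sin_pow, ih]
    push_cast
    rw [show (k : ℝ) + 2 + 1 = (k + 1) + 2 by ring, Gamma_step (x := k + 1) (by positivity),
      Gamma_step (x := k + 2) (by positivity)]
    simp
    field_simp

theorem sphereArea_div_sphereArea {m : ℕ} (hm : m ≠ 0) :
    sphereArea m / sphereArea (m + 1) = sinPowConst m := by
  have hΓ₁ : Real.Gamma (((m : ℝ) + 1) / 2) ≠ 0 := (Real.Gamma_pos_of_pos (by positivity)).ne'
  have hΓ₂ : Real.Gamma (((m : ℝ) + 2) / 2) ≠ 0 := (Real.Gamma_pos_of_pos (by positivity)).ne'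
  have hpow : Real.pi ^ (((m : ℝ) + 1) / 2) ≠ 0 := (Real.rpow_pos_of_pos Real.pi_pos _).ne'
  have hsqrt : √Real.pi ≠ 0 := by positivity
  rw [sinPowConst, integral_sin_pow_eq_Gamma, sphereArea, sphereArea, if_neg hm,
    if_neg (Nat.succ_ne_zero m)]
  push_cast
  rw [show ((m : ℝ) + 1 + 1) / 2 = ((m : ℝ) + 1) / 2 + 1 / 2 by ring,
    Real.rpow_add Real.pi_pos, ← Real.sqrt_eq_rpow,
    show ((m : ℝ) + 1) / 2 + 1 / 2 = ((m : ℝ) + 2) / 2 by ring]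
  field_simp

end LogSine

/-! ### Positive definiteness of the logarithmic kernel -/

section IteratedIntegral

variable {α β : Type*} [MeasurableSpace α] [MeasurableSpace β] {μ : Measure α} {ν : Measure β}
  {f g : α → β → ℝ≥0∞}

theorem lintegral_lintegral_mono_ae (h : ∀ᵐ x ∂μ, ∀ᵐ y ∂ν, f x y ≤ g x y) :
    ∫⁻ x, ∫⁻ y, f x y ∂ν ∂μ ≤ ∫⁻ x, ∫⁻ y, g x y ∂ν ∂μ :=
  lintegral_mono_ae (h.mono fun _ ↦ lintegral_mono_ae)

theorem lintegral_lintegral_congr_ae (h : ∀ᵐ x ∂μ, ∀ᵐ y ∂ν, f x y = g x y) :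
    ∫⁻ x, ∫⁻ y, f x y ∂ν ∂μ = ∫⁻ x, ∫⁻ y, g x y ∂ν ∂μ :=
  lintegral_congr_ae (h.mono fun _ ↦ lintegral_congr_ae)

theorem lintegral_lintegral_add_left [SFinite ν] (hf : Measurable (Function.uncurry f))
    (g : α → β → ℝ≥0∞) :
    ∫⁻ x, ∫⁻ y, f x y + g x y ∂ν ∂μ = ∫⁻ x, ∫⁻ y, f x y ∂ν ∂μ + ∫⁻ x, ∫⁻ y, g x y ∂ν ∂μ := by
  rw [← lintegral_add_left hf.lintegral_prod_right]
  exact lintegral_congr fun x ↦ lintegral_add_left hf.of_uncurry_left _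

theorem lintegral_lintegral_add_const [IsProbabilityMeasure μ] [IsProbabilityMeasure ν]
    (f : α → β → ℝ≥0∞) (c : ℝ≥0∞) :
    ∫⁻ x, ∫⁻ y, f x y + c ∂ν ∂μ = ∫⁻ x, ∫⁻ y, f x y ∂ν ∂μ + c := by
  simp [lintegral_add_right _ measurable_const]

end IteratedIntegral

section LogKernel

variable {n : ℕ}

theorem logKernel_self (x : EuclideanSpace ℝ (Fin n)) : logKernel x x = ⊤ := by
  simp [logKernel]

theorem logKernel_of_ne {x y : EuclideanSpace ℝ (Fin n)} (h : x ≠ y) :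
    logKernel x y = ((-Real.log (dist x y) : ℝ) : EReal) := by
  rw [logKernel, ENNReal.log_inv, edist_dist, ENNReal.log_ofReal_of_pos (dist_pos.2 h),
    EReal.coe_neg]

theorem logKernel_comm (x y : EuclideanSpace ℝ (Fin n)) : logKernel x y = logKernel y x := by
  rw [logKernel, logKernel, edist_comm]

@[fun_prop]
theorem measurable_logKernel {α : Type*} [MeasurableSpace α] {f g : α → EuclideanSpace ℝ (Fin n)}
    (hf : Measurable f) (hg : Measurable g) : Measurable fun a ↦ logKernel (f a) (g a) := by
  unfold logKernel
  exact (Measurable.inv (by fun_prop)).ennreal_log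

end LogKernel

theorem lintegral_exp_neg_mul_Ioo {t A B : ℝ} (ht : 0 < t) (hAB : A ≤ B) :
    ∫⁻ v in Ioo A B, ENNReal.ofReal (Real.exp (-(t * v))) =
      ENNReal.ofReal ((Real.exp (-(t * A)) - Real.exp (-(t * B))) / t) := by
  have hderiv (v : ℝ) : HasDerivAt (fun v ↦ -Real.exp (-(t * v)) / t) (Real.exp (-(t * v))) v := by
    refine (((((hasDerivAt_id v).const_mul t).neg.exp).neg).div_const t).congr_deriv ?_
    simp [ht.ne']
  rw [← ofReal_integral_eq_lintegral_ofReal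
    ((Continuous.integrableOn_Icc (by fun_prop)).mono_set Ioo_subset_Icc_self)
    (ae_of_all _ fun v ↦ (Real.exp_pos _).le), ← integral_Ioc_eq_integral_Ioo,
    ← intervalIntegral.integral_of_le hAB,
    intervalIntegral.integral_eq_sub_of_hasDerivAt (fun v _ ↦ hderiv v)
      (Continuous.intervalIntegrable (by fun_prop) _ _)]
  congr 1
  ring

theorem lintegral_exp_neg_mul_Ioi {v : ℝ} (hv : 0 < v) :
    ∫⁻ t in Ioi (0 : ℝ), ENNReal.ofReal (Real.exp (-(t * v))) = ENNReal.ofReal v⁻¹ := by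
  simp only [fun t ↦ show -(t * v) = -v * t by ring]
  rw [← ofReal_integral_eq_lintegral_ofReal (integrableOn_exp_mul_Ioi (by linarith) 0)
    (ae_of_all _ fun v ↦ (Real.exp_pos _).le), integral_exp_mul_Ioi (by linarith)]
  simp

theorem lintegral_inv_Ioo {A B : ℝ} (hA : 0 < A) (hAB : A ≤ B) :
    ∫⁻ v in Ioo A B, ENNReal.ofReal v⁻¹ = ENNReal.ofReal (Real.log (B / A)) := by
  have hcont : ContinuousOn (fun v : ℝ ↦ v⁻¹) (Icc A B) :=
    continuousOn_id.inv₀ fun v hv ↦ (hA.trans_le hv.1).ne'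
  rw [← ofReal_integral_eq_lintegral_ofReal (hcont.integrableOn_Icc.mono_set Ioo_subset_Icc_self),
    ← integral_Ioc_eq_integral_Ioo, ← intervalIntegral.integral_of_le hAB,
    integral_inv_of_pos hA (hA.trans_le hAB)]
  filter_upwards [ae_restrict_mem measurableSet_Ioo] with v hv
  exact inv_nonneg.2 (hA.trans hv.1).le

theorem lintegral_inv_Ioo_zero {B : ℝ} (hB : 0 < B) :
    ∫⁻ v in Ioo 0 B, ENNReal.ofReal v⁻¹ = ⊤ := by
  refine ENNReal.eq_top_of_forall_nnreal_le fun N ↦ ?_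
  have hle : B * Real.exp (-N) ≤ B := mul_le_of_le_one_right hB.le (by simp)
  calc (N : ℝ≥0∞) = ∫⁻ v in Ioo (B * Real.exp (-N)) B, ENNReal.ofReal v⁻¹ := by
        rw [lintegral_inv_Ioo (by positivity) hle, div_mul_cancel_left₀ hB.ne', ← Real.exp_neg]
        simp
    _ ≤ _ := lintegral_mono_set (Ioo_subset_Ioo_left (by positivity))

theorem lintegral_frullani_exp {A B : ℝ} (hA : 0 ≤ A) (hAB : A ≤ B) :
    ∫⁻ t in Ioi (0 : ℝ), ENNReal.ofReal ((Real.exp (-(t * A)) - Real.exp (-(t * B))) / t) =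
      ∫⁻ v in Ioo A B, ENNReal.ofReal v⁻¹ := by
  calc _ = ∫⁻ t in Ioi (0 : ℝ), ∫⁻ v in Ioo A B, ENNReal.ofReal (Real.exp (-(t * v))) :=
        setLIntegral_congr_fun measurableSet_Ioi fun t ht ↦ (lintegral_exp_neg_mul_Ioo ht hAB).symm
    _ = ∫⁻ v in Ioo A B, ∫⁻ t in Ioi (0 : ℝ), ENNReal.ofReal (Real.exp (-(t * v))) :=
        lintegral_lintegral_swap (by fun_prop)
    _ = _ := setLIntegral_congr_fun measurableSet_Ioo fun v hv ↦
        lintegral_exp_neg_mul_Ioi (hA.trans_lt hv.1)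

/-- The Gaussian kernel `exp (-t |x - y| ^ 2)`, of which the logarithmic kernel is a superposition
over `t`. -/
noncomputable def gaussKernel {V : Type*} [PseudoMetricSpace V] (t : ℝ) (x y : V) : ℝ≥0∞ :=
  ENNReal.ofReal (Real.exp (-(t * dist x y ^ 2)))

/-- The mutual energy of two measures for the Gaussian kernel. -/
noncomputable def gaussEnergy {V : Type*} [PseudoMetricSpace V] [MeasurableSpace V] (t : ℝ)
    (μ ν : Measure V) : ℝ≥0∞ :=
  ∫⁻ x, ∫⁻ y, gaussKernel t x y ∂ν ∂μ

@[fun_prop]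
theorem measurable_gaussKernel {α V : Type*} [MeasurableSpace α] [PseudoMetricSpace V]
    [SecondCountableTopology V] [MeasurableSpace V] [OpensMeasurableSpace V] (t : ℝ) {f g : α → V}
    (hf : Measurable f) (hg : Measurable g) : Measurable fun a ↦ gaussKernel t (f a) (g a) := by
  unfold gaussKernel
  fun_prop

theorem ofReal_exp_le_gaussKernel {V : Type*} [PseudoMetricSpace V] {t R : ℝ} (ht : 0 ≤ t)
    {x y : V} (hxy : dist x y ≤ R) :
    ENNReal.ofReal (Real.exp (-(t * R ^ 2))) ≤ gaussKernel t x y := by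
  unfold gaussKernel
  gcongr

theorem gaussEnergy_eq_add_exp {V : Type*} [PseudoMetricSpace V] [MeasurableSpace V] {t R : ℝ}
    (ht : 0 ≤ t) {μ ν : Measure V} [IsProbabilityMeasure μ] [IsProbabilityMeasure ν]
    (hd : ∀ᵐ x ∂μ, ∀ᵐ y ∂ν, dist x y ≤ R) :
    gaussEnergy t μ ν =
      (∫⁻ x, ∫⁻ y, gaussKernel t x y - ENNReal.ofReal (Real.exp (-(t * R ^ 2))) ∂ν ∂μ) +
        ENNReal.ofReal (Real.exp (-(t * R ^ 2))) := by
  set e := ENNReal.ofReal (Real.exp (-(t * R ^ 2)))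
  calc gaussEnergy t μ ν = ∫⁻ x, ∫⁻ y, (gaussKernel t x y - e) + e ∂ν ∂μ := by
        refine lintegral_lintegral_congr_ae (hd.mono fun x hx ↦ hx.mono fun y hy ↦ ?_)
        exact (tsub_add_cancel_of_le (ofReal_exp_le_gaussKernel ht hy)).symm
    _ = _ := lintegral_lintegral_add_const _ e

theorem two_mul_mul_le_mul_self_add_mul_self (a b : ℝ≥0∞) : 2 * (a * b) ≤ a * a + b * b := by
  rcases eq_or_ne a ⊤ with rfl | ha
  · simp
  rcases eq_or_ne b ⊤ with rfl | hb
  · simp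
  lift a to NNReal using ha
  lift b to NNReal using hb
  norm_cast
  simpa only [sq, mul_assoc] using two_mul_le_add_sq a b

section GaussEnergy

variable {V : Type*} [NormedAddCommGroup V] [InnerProductSpace ℝ V]

theorem two_mul_dist_sq_add_two_mul_dist_sq (x y z : V) :
    2 * dist x z ^ 2 + 2 * dist y z ^ 2 =
      dist x y ^ 2 + 4 * ‖z - (1 / 2 : ℝ) • (x + y)‖ ^ 2 := by
  have hlaw := parallelogram_law_with_norm ℝ (x - z) (y - z)
  have hadd : x - z + (y - z) = (-2 : ℝ) • (z - (1 / 2 : ℝ) • (x + y)) := by module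
  rw [hadd, norm_smul, sub_sub_sub_cancel_right] at hlaw
  simp only [dist_eq_norm]
  norm_num at hlaw ⊢
  linarith

variable [FiniteDimensional ℝ V] [MeasurableSpace V] [BorelSpace V]

theorem integral_gaussian_pos {b : ℝ} (hb : 0 < b) : 0 < ∫ z : V, Real.exp (-b * ‖z‖ ^ 2) := by
  rw [GaussianFourier.integral_rexp_neg_mul_sq_norm hb]
  positivity

theorem lintegral_gaussian_eq_ofReal {b : ℝ} (hb : 0 < b) :
    ∫⁻ z : V, ENNReal.ofReal (Real.exp (-b * ‖z‖ ^ 2)) =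
      ENNReal.ofReal (∫ z : V, Real.exp (-b * ‖z‖ ^ 2)) :=
  (ofReal_integral_eq_lintegral_ofReal (.of_integral_ne_zero (integral_gaussian_pos hb).ne')
    (ae_of_all _ fun _ ↦ (Real.exp_pos _).le)).symm

theorem lintegral_gaussKernel_mul_gaussKernel (t : ℝ) (x y : V) :
    ∫⁻ z, gaussKernel (2 * t) x z * gaussKernel (2 * t) y z =
      gaussKernel t x y * ∫⁻ z : V, ENNReal.ofReal (Real.exp (-(4 * t) * ‖z‖ ^ 2)) := by
  rw [← lintegral_const_mul _ (by fun_prop), ← lintegral_sub_right_eq_self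
    (fun z ↦ gaussKernel t x y * ENNReal.ofReal (Real.exp (-(4 * t) * ‖z‖ ^ 2)))
    ((1 / 2 : ℝ) • (x + y))]
  refine lintegral_congr fun z ↦ ?_
  simp only [gaussKernel]
  rw [← ENNReal.ofReal_mul (Real.exp_pos _).le, ← ENNReal.ofReal_mul (Real.exp_pos _).le,
    ← Real.exp_add, ← Real.exp_add]
  congr 2
  linear_combination (-t) * two_mul_dist_sq_add_two_mul_dist_sq x y z

theorem gaussEnergy_mul_lintegral_gaussian (t : ℝ) (μ ν : Measure V) [SFinite μ] [SFinite ν] :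
    gaussEnergy t μ ν * ∫⁻ z : V, ENNReal.ofReal (Real.exp (-(4 * t) * ‖z‖ ^ 2)) =
      ∫⁻ z, (∫⁻ x, gaussKernel (2 * t) x z ∂μ) * ∫⁻ y, gaussKernel (2 * t) y z ∂ν := by
  rw [gaussEnergy, ← lintegral_mul_const _ (by fun_prop)]
  calc _ = ∫⁻ x, ∫⁻ y, ∫⁻ z, gaussKernel (2 * t) x z * gaussKernel (2 * t) y z ∂volume ∂ν ∂μ := by
        refine lintegral_congr fun x ↦ ?_
        rw [← lintegral_mul_const _ (by fun_prop)]
        exact lintegral_congr fun y ↦ (lintegral_gaussKernel_mul_gaussKernel t x y).symm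
    _ = ∫⁻ x, ∫⁻ z, ∫⁻ y, gaussKernel (2 * t) x z * gaussKernel (2 * t) y z ∂ν ∂volume ∂μ :=
        lintegral_congr fun x ↦ lintegral_lintegral_swap (by fun_prop)
    _ = ∫⁻ z, ∫⁻ x, ∫⁻ y, gaussKernel (2 * t) x z * gaussKernel (2 * t) y z ∂ν ∂μ :=
        lintegral_lintegral_swap (by fun_prop)
    _ = _ := by
        refine lintegral_congr fun z ↦ ?_
        rw [← lintegral_mul_const _ (by fun_prop)]
        exact lintegral_congr fun x ↦ lintegral_const_mul _ (by fun_prop)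

theorem two_mul_gaussEnergy_le {t : ℝ} (ht : 0 < t) (μ ν : Measure V) [SFinite μ] [SFinite ν] :
    2 * gaussEnergy t μ ν ≤ gaussEnergy t μ μ + gaussEnergy t ν ν := by
  have hgauss := lintegral_gaussian_eq_ofReal (V := V) (b := 4 * t) (by positivity)
  have hpos := ENNReal.ofReal_pos.2 (integral_gaussian_pos (V := V) (b := 4 * t) (by positivity))
  rw [← ENNReal.mul_le_mul_iff_left (hgauss ▸ hpos.ne') (hgauss ▸ ENNReal.ofReal_ne_top),
    mul_assoc, add_mul, gaussEnergy_mul_lintegral_gaussian, gaussEnergy_mul_lintegral_gaussian,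
    gaussEnergy_mul_lintegral_gaussian, ← lintegral_const_mul _ (by fun_prop),
    ← lintegral_add_left (by fun_prop)]
  exact lintegral_mono fun z ↦ two_mul_mul_le_mul_self_add_mul_self _ _

end GaussEnergy

section ShiftedEnergy

variable {n : ℕ}

/-- The mutual energy of two measures for the kernel `(ln (1 / |x - y|) + c)⁺`. -/
noncomputable def shiftedEnergy (c : ℝ) (μ ν : Measure (EuclideanSpace ℝ (Fin n))) : ℝ≥0∞ :=
  ∫⁻ x, ∫⁻ y, (logKernel x y + (c : EReal)).toENNReal ∂ν ∂μ

theorem ae_dist_le_of_ae_norm_le {μ ν : Measure (EuclideanSpace ℝ (Fin n))} {r s : ℝ}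
    (hμ : ∀ᵐ x ∂μ, ‖x‖ ≤ r) (hν : ∀ᵐ y ∂ν, ‖y‖ ≤ s) : ∀ᵐ x ∂μ, ∀ᵐ y ∂ν, dist x y ≤ r + s := by
  filter_upwards [hμ] with x hx
  filter_upwards [hν] with y hy
  exact (dist_le_norm_add_norm x y).trans (add_le_add hx hy)

theorem toENNReal_logKernel_add_log {x y : EuclideanSpace ℝ (Fin n)} {R : ℝ} (hR : 0 < R)
    (hxy : dist x y ≤ R) :
    (logKernel x y + (Real.log R : EReal)).toENNReal =
      (∫⁻ v in Ioo (dist x y ^ 2) (R ^ 2), ENNReal.ofReal v⁻¹) / 2 := by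
  rcases eq_or_ne x y with rfl | h
  · rw [logKernel_self, dist_self, zero_pow two_ne_zero, lintegral_inv_Ioo_zero (by positivity),
      EReal.top_add_coe, ENNReal.top_div_of_ne_top (by simp), EReal.toENNReal_top]
  · have hd := dist_pos.2 h
    rw [logKernel_of_ne h, lintegral_inv_Ioo (by positivity) (by gcongr), ← div_pow, Real.log_pow,
      Real.log_div hR.ne' hd.ne', ← EReal.coe_add, EReal.real_coe_toENNReal,
      Nat.cast_ofNat, ENNReal.ofReal_mul two_pos.le, ENNReal.ofReal_ofNat, neg_add_eq_sub,
      mul_comm 2, ENNReal.mul_div_cancel_right two_ne_zero ENNReal.ofNat_ne_top]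

theorem toENNReal_logKernel_add_log_eq_lintegral_gaussKernel {x y : EuclideanSpace ℝ (Fin n)}
    {R : ℝ} (hR : 0 < R) (hxy : dist x y ≤ R) :
    (logKernel x y + (Real.log R : EReal)).toENNReal =
      ∫⁻ t in Ioi (0 : ℝ), (gaussKernel t x y - ENNReal.ofReal (Real.exp (-(t * R ^ 2)))) *
        (ENNReal.ofReal (2 * t))⁻¹ := by
  rw [toENNReal_logKernel_add_log hR hxy, ← lintegral_frullani_exp (by positivity) (by gcongr),
    div_eq_mul_inv, ← lintegral_mul_const _ (by fun_prop)]
  refine setLIntegral_congr_fun measurableSet_Ioi fun t (ht : 0 < t) ↦ ?_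
  rw [gaussKernel, ← ENNReal.ofReal_sub _ (Real.exp_pos _).le, ENNReal.ofReal_div_of_pos ht,
    ENNReal.ofReal_mul two_pos.le, ENNReal.mul_inv (by simp) (by simp), ENNReal.ofReal_ofNat,
    div_eq_mul_inv, mul_assoc, mul_comm (ENNReal.ofReal t)⁻¹]

theorem shiftedEnergy_log_eq_lintegral_gaussEnergy {μ ν : Measure (EuclideanSpace ℝ (Fin n))}
    [IsProbabilityMeasure μ] [IsProbabilityMeasure ν] {R : ℝ} (hR : 0 < R)
    (hd : ∀ᵐ x ∂μ, ∀ᵐ y ∂ν, dist x y ≤ R) :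
    shiftedEnergy (Real.log R) μ ν =
      ∫⁻ t in Ioi (0 : ℝ), (gaussEnergy t μ ν - ENNReal.ofReal (Real.exp (-(t * R ^ 2)))) *
        (ENNReal.ofReal (2 * t))⁻¹ := by
  let G (t : ℝ) (x y : EuclideanSpace ℝ (Fin n)) : ℝ≥0∞ :=
    gaussKernel t x y - ENNReal.ofReal (Real.exp (-(t * R ^ 2)))
  have hG : Measurable fun p : (EuclideanSpace ℝ (Fin n) × ℝ) × EuclideanSpace ℝ (Fin n) ↦
      G p.1.2 p.1.1 p.2 * (ENNReal.ofReal (2 * p.1.2))⁻¹ := by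
    simp only [G, gaussKernel]
    fun_prop
  calc _ = ∫⁻ x, ∫⁻ y, ∫⁻ t in Ioi (0 : ℝ), G t x y * (ENNReal.ofReal (2 * t))⁻¹
        ∂volume ∂ν ∂μ := by
        refine lintegral_lintegral_congr_ae (hd.mono fun x hx ↦ hx.mono fun y hy ↦ ?_)
        exact toENNReal_logKernel_add_log_eq_lintegral_gaussKernel hR hy
    _ = ∫⁻ x, ∫⁻ t in Ioi (0 : ℝ), ∫⁻ y, G t x y * (ENNReal.ofReal (2 * t))⁻¹ ∂ν ∂volume ∂μ :=
        lintegral_congr fun x ↦ lintegral_lintegral_swap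
          (hG.comp (f := fun p : EuclideanSpace ℝ (Fin n) × ℝ ↦ ((x, p.2), p.1))
            (by fun_prop)).aemeasurable
    _ = ∫⁻ t in Ioi (0 : ℝ), ∫⁻ x, ∫⁻ y, G t x y * (ENNReal.ofReal (2 * t))⁻¹ ∂ν ∂μ :=
        lintegral_lintegral_swap hG.lintegral_prod_right'.aemeasurable
    _ = ∫⁻ t in Ioi (0 : ℝ), (∫⁻ x, ∫⁻ y, G t x y ∂ν ∂μ) * (ENNReal.ofReal (2 * t))⁻¹ := by
        refine lintegral_congr fun t ↦ ?_
        rw [← lintegral_mul_const _ (by fun_prop)]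
        exact lintegral_congr fun x ↦ lintegral_mul_const _ (by fun_prop)
    _ = _ := setLIntegral_congr_fun measurableSet_Ioi fun t (ht : 0 < t) ↦ by
        rw [gaussEnergy_eq_add_exp ht.le hd, ENNReal.add_sub_cancel_right ENNReal.ofReal_ne_top]

theorem two_mul_shiftedEnergy_le {μ ν : Measure (EuclideanSpace ℝ (Fin n))}
    [IsProbabilityMeasure μ] [IsProbabilityMeasure ν] {R : ℝ} (hR : 0 < R)
    (hμ : ∀ᵐ x ∂μ, ‖x‖ ≤ R / 2) (hν : ∀ᵐ x ∂ν, ‖x‖ ≤ R / 2) :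
    2 * shiftedEnergy (Real.log R) μ ν ≤
      shiftedEnergy (Real.log R) μ μ + shiftedEnergy (Real.log R) ν ν := by
  have hμν := add_halves R ▸ ae_dist_le_of_ae_norm_le hμ hν
  have hμμ := add_halves R ▸ ae_dist_le_of_ae_norm_le hμ hμ
  have hνν := add_halves R ▸ ae_dist_le_of_ae_norm_le hν hν
  rw [shiftedEnergy_log_eq_lintegral_gaussEnergy hR hμν,
    shiftedEnergy_log_eq_lintegral_gaussEnergy hR hμμ,
    shiftedEnergy_log_eq_lintegral_gaussEnergy hR hνν, ← lintegral_const_mul' _ _ (by simp),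
    ← lintegral_add_left (by unfold gaussEnergy gaussKernel; fun_prop)]
  refine setLIntegral_mono' measurableSet_Ioi fun t (ht : 0 < t) ↦ ?_
  rw [← mul_assoc, ← add_mul]
  gcongr
  have hle := two_mul_gaussEnergy_le ht μ ν
  rw [gaussEnergy_eq_add_exp ht.le hμν, gaussEnergy_eq_add_exp ht.le hμμ,
    gaussEnergy_eq_add_exp ht.le hνν, mul_add, add_add_add_comm, ← two_mul] at hle
  rw [gaussEnergy_eq_add_exp ht.le hμν, gaussEnergy_eq_add_exp ht.le hμμ,
    gaussEnergy_eq_add_exp ht.le hνν]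
  simp only [ENNReal.add_sub_cancel_right ENNReal.ofReal_ne_top]
  exact (ENNReal.add_le_add_iff_right (by finiteness)).1 hle

end ShiftedEnergy

/-! ### Equilibrium energies of balls -/

section SpherePotential

variable {m : ℕ} {ρ : ℝ}

/-- The minimal logarithmic energy (Robin constant) of the closed unit ball of `ℝ^{m+2}`. -/
noncomputable def ballRobin (m : ℕ) : ℝ := -(sinPowConst m / 2 * logSineIntegral m 1)

theorem logSqDist_le_two_mul_log_two (hρ : |ρ| ≤ 1) (θ : ℝ) :
    logSqDist ρ θ ≤ 2 * Real.log 2 := by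
  rw [logSqDist_eq_two_mul_log_norm]
  refine mul_le_mul_of_nonneg_left ?_ two_pos.le
  rcases (norm_nonneg (circleMap 0 1 θ - ρ)).eq_or_lt' with h | h
  · rw [h, Real.log_zero]
    exact Real.log_nonneg one_le_two
  · refine Real.log_le_log h ((norm_sub_le _ _).trans ?_)
    rw [norm_circleMap_zero, abs_one, Complex.norm_real, Real.norm_eq_abs]
    linarith

theorem intervalIntegrable_sin_pow_mul_log_two_sub (m : ℕ) (ρ : ℝ) :
    IntervalIntegrable (fun θ ↦ Real.sin θ ^ m * (Real.log 2 - logSqDist ρ θ / 2)) volume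
      0 Real.pi := by
  have hconst : IntervalIntegrable (fun θ ↦ Real.sin θ ^ m * Real.log 2) volume 0 Real.pi :=
    Continuous.intervalIntegrable (by fun_prop) _ _
  simpa only [mul_sub, mul_div_assoc] using
    hconst.sub ((intervalIntegrable_sin_pow_mul_logSqDist m ρ).div_const 2)

theorem sinPowConst_mul_integral_log_two_sub (m : ℕ) (ρ : ℝ) :
    sinPowConst m * ∫ θ in (0 : ℝ)..Real.pi, Real.sin θ ^ m * (Real.log 2 - logSqDist ρ θ / 2) =
      Real.log 2 - sinPowConst m / 2 * logSineIntegral m ρ := by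
  have hconst : IntervalIntegrable (fun θ ↦ Real.sin θ ^ m * Real.log 2) volume 0 Real.pi :=
    Continuous.intervalIntegrable (by fun_prop) _ _
  simp only [mul_sub, ← mul_div_assoc]
  rw [intervalIntegral.integral_sub hconst
    ((intervalIntegrable_sin_pow_mul_logSqDist m ρ).div_const 2),
    intervalIntegral.integral_mul_const, intervalIntegral.integral_div, mul_sub, ← mul_assoc,
    sinPowConst, inv_mul_cancel₀ (integral_sin_pow_pos m).ne', logSineIntegral]
  ring

theorem log_two_add_ballRobin_nonneg (m : ℕ) : 0 ≤ Real.log 2 + ballRobin m := by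
  rw [ballRobin, ← sub_eq_add_neg, ← sinPowConst_mul_integral_log_two_sub]
  refine mul_nonneg (sinPowConst_pos m).le
    (intervalIntegral.integral_nonneg Real.pi_pos.le fun θ hθ ↦ ?_)
  have hlog : logSqDist 1 θ ≤ 2 * Real.log 2 := logSqDist_le_two_mul_log_two abs_one.le θ
  exact mul_nonneg (pow_nonneg (Real.sin_nonneg_of_mem_Icc hθ) _) (by linarith)

theorem lintegral_sin_pow_mul_log_two_sub (m : ℕ) (hρ : |ρ| ≤ 1) :
    ENNReal.ofReal (sinPowConst m) * ∫⁻ θ in Ioo 0 Real.pi, ENNReal.ofReal (Real.sin θ ^ m) *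
        ENNReal.ofReal (Real.log 2 - logSqDist ρ θ / 2) =
      ENNReal.ofReal (Real.log 2 - sinPowConst m / 2 * logSineIntegral m ρ) := by
  have hnonneg (θ : ℝ) : 0 ≤ Real.log 2 - logSqDist ρ θ / 2 := by
    linarith [logSqDist_le_two_mul_log_two hρ θ]
  have hsin {θ : ℝ} (hθ : θ ∈ Ioo 0 Real.pi) : 0 ≤ Real.sin θ ^ m :=
    pow_nonneg (Real.sin_pos_of_pos_of_lt_pi hθ.1 hθ.2).le _
  rw [← sinPowConst_mul_integral_log_two_sub, ENNReal.ofReal_mul (sinPowConst_pos m).le,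
    intervalIntegral.integral_of_le Real.pi_pos.le, integral_Ioc_eq_integral_Ioo,
    ofReal_integral_eq_lintegral_ofReal
      ((intervalIntegrable_iff_integrableOn_Ioo_of_le Real.pi_pos.le).1
        (intervalIntegrable_sin_pow_mul_log_two_sub m ρ))
      ((ae_restrict_iff' measurableSet_Ioo).2
        (ae_of_all _ fun θ hθ ↦ mul_nonneg (hsin hθ) (hnonneg θ)))]
  congr 1
  exact setLIntegral_congr_fun measurableSet_Ioo fun θ hθ ↦ (ENNReal.ofReal_mul (hsin hθ)).symm

theorem dist_single_zero {y : EuclideanSpace ℝ (Fin (m + 2))} (ρ : ℝ) (hy : ‖y‖ = 1) :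
    dist (EuclideanSpace.single 0 ρ) y = √(1 + ρ ^ 2 - 2 * ρ * y 0) := by
  rw [dist_eq_norm, ← Real.sqrt_sq (norm_nonneg _), norm_sub_sq_real, hy,
    EuclideanSpace.inner_single_left, PiLp.norm_single, Real.norm_eq_abs, sq_abs]
  congr 1
  simp only [conj_trivial]
  ring

theorem lintegral_logKernel_single_unitSphereMeasure (m : ℕ) (hρ : |ρ| ≤ 1) :
    ∫⁻ y, (logKernel (EuclideanSpace.single 0 ρ) y + (Real.log 2 : EReal)).toENNReal
        ∂unitSphereMeasure (m + 2) =
      ENNReal.ofReal (Real.log 2 - sinPowConst m / 2 * logSineIntegral m ρ) := by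
  let g (c : ℝ) : ℝ≥0∞ := (ENNReal.log (ENNReal.ofReal √(1 + ρ ^ 2 - 2 * ρ * c))⁻¹ +
    (Real.log 2 : EReal)).toENNReal
  have hg : Measurable g :=
    ((Measurable.inv (by fun_prop)).ennreal_log.add_const _).ereal_toENNReal
  have hcos {θ : ℝ} (hθ : θ ∈ Ioo 0 Real.pi) :
      g (Real.cos θ) = ENNReal.ofReal (Real.log 2 - logSqDist ρ θ / 2) := by
    have hpos := logSqDist_arg_pos hθ ρ
    simp only [g]
    rw [ENNReal.log_inv, ENNReal.log_ofReal_of_pos (Real.sqrt_pos.2 hpos), ← EReal.coe_neg,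
      ← EReal.coe_add, EReal.real_coe_toENNReal, Real.log_sqrt hpos.le, neg_add_eq_sub, logSqDist]
  calc _ = ∫⁻ y, g (y 0) ∂unitSphereMeasure (m + 2) := by
        refine lintegral_congr_ae ?_
        filter_upwards [ae_norm_eq_one_unitSphereMeasure (Nat.succ_ne_zero (m + 1))] with y hy
        simp only [g]
        rw [logKernel, edist_dist, dist_single_zero ρ hy]
    _ = _ := lintegral_unitSphereMeasure_apply_zero m hg
    _ = _ := by
        rw [← lintegral_sin_pow_mul_log_two_sub m hρ,
          setLIntegral_congr_fun measurableSet_Ioo fun θ hθ ↦ by rw [hcos hθ]]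

theorem lintegral_logKernel_unitSphereMeasure {x : EuclideanSpace ℝ (Fin (m + 2))}
    (hx : ‖x‖ ≤ 1) :
    ∫⁻ y, (logKernel x y + (Real.log 2 : EReal)).toENNReal ∂unitSphereMeasure (m + 2) =
      ENNReal.ofReal (Real.log 2 - sinPowConst m / 2 * logSineIntegral m ‖x‖) := by
  obtain ⟨e, he⟩ : ∃ e : EuclideanSpace ℝ (Fin (m + 2)) ≃ₗᵢ[ℝ] EuclideanSpace ℝ (Fin (m + 2)),
      e x = EuclideanSpace.single 0 ‖x‖ :=
    ⟨_, Submodule.reflection_sub (by simp)⟩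
  rw [← lintegral_logKernel_single_unitSphereMeasure m (ρ := ‖x‖) (by rwa [abs_norm]),
    ← lintegral_unitSphereMeasure_comp_isometry e
      (f := fun y ↦ (logKernel (EuclideanSpace.single 0 ‖x‖) y + (Real.log 2 : EReal)).toENNReal)
      (by fun_prop), ← he]
  simp only [logKernel, e.isometry.edist_eq]

theorem shiftedEnergy_unitSphereMeasure (m : ℕ) :
    shiftedEnergy (Real.log 2) (unitSphereMeasure (m + 2)) (unitSphereMeasure (m + 2)) =
      ENNReal.ofReal (Real.log 2 + ballRobin m) := by
  calc _ = ∫⁻ _, ENNReal.ofReal (Real.log 2 + ballRobin m) ∂unitSphereMeasure (m + 2) := by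
        refine lintegral_congr_ae ?_
        filter_upwards [ae_norm_eq_one_unitSphereMeasure (Nat.succ_ne_zero (m + 1))] with y hy
        rw [lintegral_logKernel_unitSphereMeasure hy.le, hy, ballRobin, sub_eq_add_neg]
    _ = _ := by simp

theorem le_shiftedEnergy_unitSphereMeasure {μ : Measure (EuclideanSpace ℝ (Fin (m + 2)))}
    [IsProbabilityMeasure μ] (hμ : ∀ᵐ x ∂μ, ‖x‖ ≤ 1) :
    ENNReal.ofReal (Real.log 2 + ballRobin m) ≤
      shiftedEnergy (Real.log 2) μ (unitSphereMeasure (m + 2)) := by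
  calc _ = ∫⁻ _, ENNReal.ofReal (Real.log 2 + ballRobin m) ∂μ := by simp
    _ ≤ _ := by
      refine lintegral_mono_ae ?_
      filter_upwards [hμ] with x hx
      rw [lintegral_logKernel_unitSphereMeasure hx, ballRobin, ← sub_eq_add_neg]
      have hle := logSineIntegral_le_one m (ρ := ‖x‖) (by rwa [abs_norm])
      have hc := (sinPowConst_pos m).le
      gcongr

theorem le_shiftedEnergy_self {μ : Measure (EuclideanSpace ℝ (Fin (m + 2)))}
    [IsProbabilityMeasure μ] (hμ : ∀ᵐ x ∂μ, ‖x‖ ≤ 1) :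
    ENNReal.ofReal (Real.log 2 + ballRobin m) ≤ shiftedEnergy (Real.log 2) μ μ := by
  have hsphere : ∀ᵐ y ∂unitSphereMeasure (m + 2), ‖y‖ ≤ 2 / 2 := by
    filter_upwards [ae_norm_eq_one_unitSphereMeasure (Nat.succ_ne_zero (m + 1))] with y hy
    simp [hy]
  have hpolar := two_mul_shiftedEnergy_le two_pos (by simpa using hμ) hsphere
  rw [shiftedEnergy_unitSphereMeasure] at hpolar
  rw [← ENNReal.add_le_add_iff_right (a := ENNReal.ofReal (Real.log 2 + ballRobin m)) (by simp),
    ← two_mul]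
  refine le_trans ?_ hpolar
  gcongr
  exact le_shiftedEnergy_unitSphereMeasure hμ

end SpherePotential

section LogEnergy

variable {n : ℕ}

theorem toENNReal_add_coe_add_of_nonneg {F : EReal} {h : ℝ} (hF : 0 ≤ F + h) :
    (F + h).toENNReal + (-F).toENNReal + ENNReal.ofReal (-h) =
      F.toENNReal + ENNReal.ofReal h := by
  induction F with
  | bot => simp at hF
  | top => simp
  | coe a =>
    rw [← EReal.coe_add, EReal.coe_nonneg] at hF
    rw [← EReal.coe_add, ← EReal.coe_neg]
    simp only [EReal.real_coe_toENNReal]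
    rw [← ENNReal.toReal_eq_toReal_iff' (by finiteness) (by finiteness)]
    repeat rw [ENNReal.toReal_add (by finiteness) (by finiteness)]
    simp only [ENNReal.toReal_ofReal', max_eq_left hF]
    linarith [max_zero_sub_max_neg_zero_eq_self a, max_zero_sub_max_neg_zero_eq_self h]

theorem coe_sub_coe_eq_of_add_eq {a b d : ℝ≥0∞} {c : ℝ} (hb : b ≠ ⊤)
    (h : a + b + ENNReal.ofReal (-c) = d + ENNReal.ofReal c) :
    (d : EReal) - (b : EReal) = (a : EReal) - (c : EReal) := by
  lift b to NNReal using hb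
  have htop : a = ⊤ ↔ d = ⊤ := by simpa using congrArg (· = ⊤) h
  rcases eq_or_ne d ⊤ with rfl | hd
  · rw [htop.2 rfl]
    rfl
  · lift a to NNReal using mt htop.1 hd
    lift d to NNReal using hd
    have hreal := congrArg ENNReal.toReal h
    rw [ENNReal.toReal_add (by finiteness) (by finiteness),
      ENNReal.toReal_add (by finiteness) (by finiteness),
      ENNReal.toReal_add (by finiteness) (by finiteness),
      ENNReal.toReal_ofReal', ENNReal.toReal_ofReal'] at hreal
    simp only [ENNReal.coe_toReal] at hreal
    change ((d : ℝ) : EReal) - ((b : ℝ) : EReal) = ((a : ℝ) : EReal) - (c : EReal)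
    rw [← EReal.coe_sub, ← EReal.coe_sub]
    congr 1
    linarith [max_zero_sub_max_neg_zero_eq_self c]

/-- The logarithmic energy of a measure, whose infimum over the unit measures carried by a set is
the Robin mass `nrob`. -/
noncomputable def logEnergy (μ : Measure (EuclideanSpace ℝ (Fin n))) : EReal :=
  (posEnergy μ μ : EReal) - (negEnergy μ μ : EReal)

theorem neg_log_le_logKernel {x y : EuclideanSpace ℝ (Fin n)} {R : ℝ} (h : dist x y ≤ R) :
    ((-Real.log R : ℝ) : EReal) ≤ logKernel x y := by
  rcases eq_or_ne x y with rfl | hxy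
  · simp [logKernel_self]
  · rw [logKernel_of_ne hxy, EReal.coe_le_coe_iff, neg_le_neg_iff]
    exact Real.log_le_log (dist_pos.2 hxy) h

theorem toENNReal_neg_logKernel_le {x y : EuclideanSpace ℝ (Fin n)} {R : ℝ} (h : dist x y ≤ R) :
    (-logKernel x y).toENNReal ≤ ENNReal.ofReal (Real.log R) := by
  rw [← EReal.real_coe_toENNReal]
  refine EReal.toENNReal_le_toENNReal (EReal.neg_le.1 ?_)
  exact_mod_cast neg_log_le_logKernel h

theorem negEnergy_le_of_dist_le {μ ν : Measure (EuclideanSpace ℝ (Fin n))} [IsProbabilityMeasure μ]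
    [IsProbabilityMeasure ν] {R : ℝ} (hd : ∀ᵐ x ∂μ, ∀ᵐ y ∂ν, dist x y ≤ R) :
    negEnergy μ ν ≤ ENNReal.ofReal (Real.log R) := by
  calc negEnergy μ ν ≤ ∫⁻ _, ∫⁻ _, ENNReal.ofReal (Real.log R) ∂ν ∂μ :=
        lintegral_lintegral_mono_ae
          (hd.mono fun _ hx ↦ hx.mono fun _ ↦ toENNReal_neg_logKernel_le)
    _ = _ := by simp

theorem shiftedEnergy_add_negEnergy {μ ν : Measure (EuclideanSpace ℝ (Fin n))}
    [IsProbabilityMeasure μ] [IsProbabilityMeasure ν] {c : ℝ}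
    (hc : ∀ᵐ x ∂μ, ∀ᵐ y ∂ν, 0 ≤ logKernel x y + (c : EReal)) :
    shiftedEnergy c μ ν + negEnergy μ ν + ENNReal.ofReal (-c) =
      posEnergy μ ν + ENNReal.ofReal c := by
  rw [shiftedEnergy, negEnergy, posEnergy, ← lintegral_lintegral_add_left
    (by simp only [Function.uncurry_def]; fun_prop), ← lintegral_lintegral_add_const,
    ← lintegral_lintegral_add_const]
  exact lintegral_lintegral_congr_ae
    (hc.mono fun _ hx ↦ hx.mono fun _ ↦ toENNReal_add_coe_add_of_nonneg)

theorem logEnergy_eq_shiftedEnergy_sub {μ : Measure (EuclideanSpace ℝ (Fin n))}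
    [IsProbabilityMeasure μ] {R : ℝ} (hd : ∀ᵐ x ∂μ, ∀ᵐ y ∂μ, dist x y ≤ R) :
    logEnergy μ = (shiftedEnergy (Real.log R) μ μ : EReal) - (Real.log R : EReal) := by
  refine coe_sub_coe_eq_of_add_eq (ne_top_of_le_ne_top ENNReal.ofReal_ne_top
    (negEnergy_le_of_dist_le hd)) (shiftedEnergy_add_negEnergy (hd.mono fun x hx ↦ hx.mono ?_))
  intro y hy
  have := add_le_add_left (neg_log_le_logKernel hy) (Real.log R : EReal)
  rwa [← EReal.coe_add, neg_add_cancel, EReal.coe_zero] at this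

theorem logKernel_smul {r : ℝ} (hr : 0 < r) (x y : EuclideanSpace ℝ (Fin n)) :
    logKernel (r • x) (r • y) = logKernel x y - (Real.log r : EReal) := by
  rcases eq_or_ne x y with rfl | h
  · simp [logKernel_self]
  · have h' : r • x ≠ r • y := fun e ↦ h (smul_right_injective _ hr.ne' e)
    rw [logKernel_of_ne h, logKernel_of_ne h', ← EReal.coe_sub, dist_smul₀,
      Real.norm_of_nonneg hr.le, Real.log_mul hr.ne' (dist_pos.2 h).ne']
    congr 1
    ring

theorem shiftedEnergy_map_smul {r : ℝ} (hr : 0 < r) (c : ℝ)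
    (μ : Measure (EuclideanSpace ℝ (Fin n))) [SFinite μ] :
    shiftedEnergy (c + Real.log r) (μ.map (r • ·)) (μ.map (r • ·)) = shiftedEnergy c μ μ := by
  rw [shiftedEnergy, lintegral_map (Measurable.lintegral_prod_right (by fun_prop)) (by fun_prop),
    shiftedEnergy]
  refine lintegral_congr fun x ↦ ?_
  rw [lintegral_map (by fun_prop) (by fun_prop)]
  refine lintegral_congr fun y ↦ ?_
  rw [logKernel_smul hr, sub_eq_add_neg, add_assoc, ← EReal.coe_neg, ← EReal.coe_add,
    neg_add_eq_sub, add_sub_cancel_right]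

theorem isProbabilityMeasure_map_smul (r : ℝ) (μ : Measure (EuclideanSpace ℝ (Fin n)))
    [IsProbabilityMeasure μ] : IsProbabilityMeasure (μ.map (r • ·)) :=
  Measure.isProbabilityMeasure_map (by fun_prop)

theorem logEnergy_eq_shiftedEnergy_map_inv_smul {r : ℝ} (hr : 0 < r)
    {μ : Measure (EuclideanSpace ℝ (Fin n))} [IsProbabilityMeasure μ] (hμ : ∀ᵐ x ∂μ, ‖x‖ ≤ r) :
    logEnergy μ = (shiftedEnergy (Real.log 2) (μ.map (r⁻¹ • ·)) (μ.map (r⁻¹ • ·)) : EReal) -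
      ((Real.log 2 + Real.log r : ℝ) : EReal) := by
  have hd := two_mul r ▸ ae_dist_le_of_ae_norm_le hμ hμ
  have hscale := shiftedEnergy_map_smul (inv_pos.2 hr) (Real.log 2 + Real.log r) μ
  rw [Real.log_inv, add_neg_cancel_right] at hscale
  rw [hscale, logEnergy_eq_shiftedEnergy_sub hd, Real.log_mul two_ne_zero hr.ne']

end LogEnergy

section Ball

variable {m n : ℕ} {r : ℝ}

theorem coe_ofReal_log_two_add_ballRobin_sub (m : ℕ) (r : ℝ) :
    (ENNReal.ofReal (Real.log 2 + ballRobin m) : EReal) - ((Real.log 2 + Real.log r : ℝ) : EReal) =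
      ((ballRobin m - Real.log r : ℝ) : EReal) := by
  rw [EReal.coe_ennreal_ofReal, max_eq_left (log_two_add_ballRobin_nonneg m), ← EReal.coe_sub,
    add_sub_add_left_eq_sub]

theorem le_logEnergy_of_ae_norm_le (hr : 0 < r) {μ : Measure (EuclideanSpace ℝ (Fin (m + 2)))}
    [IsProbabilityMeasure μ] (hμ : ∀ᵐ x ∂μ, ‖x‖ ≤ r) :
    ((ballRobin m - Real.log r : ℝ) : EReal) ≤ logEnergy μ := by
  have := isProbabilityMeasure_map_smul r⁻¹ μ
  have hunit : ∀ᵐ x ∂μ.map (r⁻¹ • ·), ‖x‖ ≤ 1 := by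
    rw [ae_map_iff (by fun_prop) (measurableSet_le measurable_norm measurable_const)]
    filter_upwards [hμ] with x hx
    rw [norm_smul, norm_inv, Real.norm_of_nonneg hr.le]
    exact (inv_mul_le_one₀ hr).2 hx
  rw [logEnergy_eq_shiftedEnergy_map_inv_smul hr hμ, ← coe_ofReal_log_two_add_ballRobin_sub]
  exact EReal.sub_le_sub (EReal.coe_ennreal_le_coe_ennreal_iff.2 (le_shiftedEnergy_self hunit))
    le_rfl

/-- The uniform probability measure on the sphere of radius `r`. -/
noncomputable def sphereMeasure (n : ℕ) (r : ℝ) : Measure (EuclideanSpace ℝ (Fin n)) :=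
  (unitSphereMeasure n).map (r • ·)

instance (n : ℕ) (r : ℝ) : IsProbabilityMeasure (sphereMeasure n r) :=
  isProbabilityMeasure_map_smul r _

theorem ae_norm_eq_sphereMeasure (hn : n ≠ 0) (hr : 0 < r) :
    ∀ᵐ y ∂sphereMeasure n r, ‖y‖ = r := by
  rw [sphereMeasure,
    ae_map_iff (by fun_prop) (measurableSet_eq_fun measurable_norm measurable_const)]
  filter_upwards [ae_norm_eq_one_unitSphereMeasure hn] with y hy
  rw [norm_smul, hy, Real.norm_of_nonneg hr.le, mul_one]

theorem logEnergy_sphereMeasure (m : ℕ) (hr : 0 < r) :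
    logEnergy (sphereMeasure (m + 2) r) = ((ballRobin m - Real.log r : ℝ) : EReal) := by
  have hle : ∀ᵐ y ∂sphereMeasure (m + 2) r, ‖y‖ ≤ r :=
    (ae_norm_eq_sphereMeasure (Nat.succ_ne_zero _) hr).mono fun _ ↦ le_of_eq
  have hunscale : (sphereMeasure (m + 2) r).map (r⁻¹ • ·) = unitSphereMeasure (m + 2) := by
    rw [sphereMeasure, Measure.map_map (by fun_prop) (by fun_prop)]
    simp [Function.comp_def, smul_smul, inv_mul_cancel₀ hr.ne']
  rw [logEnergy_eq_shiftedEnergy_map_inv_smul hr hle, hunscale, shiftedEnergy_unitSphereMeasure,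
    coe_ofReal_log_two_add_ballRobin_sub]

theorem measure_compl_closedBall_eq_zero_iff {E : Type*} [SeminormedAddCommGroup E]
    [MeasurableSpace E] {μ : Measure E} : μ (closedBall 0 r)ᶜ = 0 ↔ ∀ᵐ x ∂μ, ‖x‖ ≤ r := by
  simp only [← mem_closedBall_zero_iff]
  exact Iff.rfl

theorem nrob_closedBall (m : ℕ) (hr : 0 < r) :
    nrob (closedBall (0 : EuclideanSpace ℝ (Fin (m + 2))) r) =
      ((ballRobin m - Real.log r : ℝ) : EReal) := by
  refine le_antisymm ?_ (le_iInf fun μ ↦ le_iInf fun _ ↦ le_iInf fun hμ ↦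
    le_logEnergy_of_ae_norm_le hr (measure_compl_closedBall_eq_zero_iff.1 hμ))
  rw [← logEnergy_sphereMeasure m hr]
  exact iInf₂_le_of_le _ inferInstance (iInf_le _ (measure_compl_closedBall_eq_zero_iff.2
    ((ae_norm_eq_sphereMeasure (Nat.succ_ne_zero _) hr).mono fun _ ↦ le_of_eq)))

theorem ncap3_closedBall (m : ℕ) (hr : 0 < r) :
    ncap3 (closedBall (0 : EuclideanSpace ℝ (Fin (m + 2))) r) =
      ENNReal.ofReal (r * Real.exp (-ballRobin m)) := by
  rw [ncap3, nrob_closedBall m hr, ← EReal.coe_neg, EReal.exp_coe, neg_sub, Real.exp_sub,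
    Real.exp_log hr, Real.exp_neg, div_eq_mul_inv]

end Ball

/-! ### The transfinite modulus of a large ball -/

section Symmetry

variable {n : ℕ} (μ ν : Measure (EuclideanSpace ℝ (Fin n))) [SFinite μ] [SFinite ν]

theorem posEnergy_comm : posEnergy μ ν = posEnergy ν μ := by
  rw [posEnergy, lintegral_lintegral_swap (by fun_prop), posEnergy]
  simp only [logKernel_comm]

theorem negEnergy_comm : negEnergy μ ν = negEnergy ν μ := by
  rw [negEnergy, lintegral_lintegral_swap (by fun_prop), negEnergy]
  simp only [logKernel_comm]

end Symmetry

section MutualEnergy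

variable {n : ℕ} {μ ν : Measure (EuclideanSpace ℝ (Fin n))} {x y : EuclideanSpace ℝ (Fin n)}
  {ρ r : ℝ}

/-- The logarithmic moment `∫ ln⁺ |y| dν(y)`. -/
noncomputable def logMoment (ν : Measure (EuclideanSpace ℝ (Fin n))) : ℝ≥0∞ :=
  ∫⁻ y, ENNReal.ofReal (Real.log ‖y‖) ∂ν

/-- `-ln (1 - ρ / r)`: the error made by replacing `ln |x - y|` with `ln |y|` when
`|x| ≤ ρ < r ≤ |y|`. -/
noncomputable def separationError (ρ r : ℝ) : ℝ := -Real.log (1 - ρ / r)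

theorem separationError_nonneg (hρ : 0 ≤ ρ) (hr : ρ < r) : 0 ≤ separationError ρ r := by
  have hq : ρ / r < 1 := (div_lt_one (hρ.trans_lt hr)).2 hr
  have hq' : 0 ≤ ρ / r := div_nonneg hρ (hρ.trans hr.le)
  exact neg_nonneg.2 (Real.log_nonpos (by linarith) (by linarith))

theorem tendsto_separationError (ρ : ℝ) : Tendsto (separationError ρ) atTop (𝓝 0) := by
  have hlim : Tendsto (fun r : ℝ ↦ 1 - ρ / r) atTop (𝓝 (1 - 0)) :=
    tendsto_const_nhds.sub (tendsto_const_nhds.div_atTop tendsto_id)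
  rw [sub_zero] at hlim
  change Tendsto (fun r ↦ -Real.log (1 - ρ / r)) atTop (𝓝 0)
  simpa [Function.comp_def] using
    ((Real.continuousAt_log one_ne_zero).tendsto.comp hlim).neg

theorem abs_log_dist_sub_log_norm_le (hρ : 0 ≤ ρ) (hr : ρ < r) (hx : ‖x‖ ≤ ρ) (hy : r ≤ ‖y‖) :
    |Real.log (dist x y) - Real.log ‖y‖| ≤ separationError ρ r := by
  have hr0 : 0 < r := hρ.trans_lt hr
  have hy0 : 0 < ‖y‖ := hr0.trans_le hy
  have hq : 0 < 1 - ρ / r := sub_pos.2 ((div_lt_one hr0).2 hr)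
  have hρy : ρ ≤ ρ / r * ‖y‖ := by
    rw [div_mul_eq_mul_div, le_div_iff₀ hr0]
    gcongr
  have hlower : ‖y‖ - ρ ≤ dist x y := by
    rw [dist_comm, dist_eq_norm]
    linarith [norm_sub_norm_le y x]
  have hupper : dist x y ≤ ‖y‖ + ρ := by linarith [dist_le_norm_add_norm x y]
  have hlog_upper : Real.log (dist x y) ≤ Real.log (‖y‖ / (1 - ρ / r)) := by
    refine Real.log_le_log (by linarith) (hupper.trans ?_)
    rw [le_div_iff₀ hq]
    nlinarith [mul_nonneg hρ (div_nonneg hρ hr0.le)]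
  have hlog_lower : Real.log (‖y‖ * (1 - ρ / r)) ≤ Real.log (dist x y) :=
    Real.log_le_log (mul_pos hy0 hq) (by linarith)
  rw [Real.log_div hy0.ne' hq.ne'] at hlog_upper
  rw [Real.log_mul hy0.ne' hq.ne'] at hlog_lower
  rw [separationError, abs_le]
  constructor <;> linarith

theorem one_le_dist (hr : ρ + 1 ≤ r) (hx : ‖x‖ ≤ ρ) (hy : r ≤ ‖y‖) : 1 ≤ dist x y := by
  rw [dist_comm, dist_eq_norm]
  linarith [norm_sub_norm_le y x]

theorem toENNReal_neg_logKernel_of_one_le_dist (h : 1 ≤ dist x y) :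
    (-logKernel x y).toENNReal = ENNReal.ofReal (Real.log (dist x y)) := by
  rw [logKernel_of_ne (dist_pos.1 (by linarith)), ← EReal.coe_neg, neg_neg,
    EReal.real_coe_toENNReal]

theorem toENNReal_logKernel_of_one_le_dist (h : 1 ≤ dist x y) : (logKernel x y).toENNReal = 0 := by
  rw [logKernel_of_ne (dist_pos.1 (by linarith)), EReal.real_coe_toENNReal,
    ENNReal.ofReal_eq_zero]
  linarith [Real.log_nonneg h]

theorem posEnergy_eq_zero (hr : ρ + 1 ≤ r) (hμ : ∀ᵐ x ∂μ, ‖x‖ ≤ ρ) (hν : ∀ᵐ y ∂ν, r ≤ ‖y‖) :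
    posEnergy μ ν = 0 := by
  calc posEnergy μ ν = ∫⁻ _, ∫⁻ _, 0 ∂ν ∂μ :=
        lintegral_lintegral_congr_ae (hμ.mono fun x hx ↦ hν.mono fun y hy ↦
          toENNReal_logKernel_of_one_le_dist (one_le_dist hr hx hy))
    _ = 0 := by simp

variable [IsProbabilityMeasure μ] [IsProbabilityMeasure ν]

theorem logMoment_le_negEnergy_add (hρ : 0 ≤ ρ) (hr : ρ + 1 ≤ r) (hμ : ∀ᵐ x ∂μ, ‖x‖ ≤ ρ)
    (hν : ∀ᵐ y ∂ν, r ≤ ‖y‖) :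
    logMoment ν ≤ negEnergy μ ν + ENNReal.ofReal (separationError ρ r) := by
  calc logMoment ν = ∫⁻ _, ∫⁻ y, ENNReal.ofReal (Real.log ‖y‖) ∂ν ∂μ := by simp [logMoment]
    _ ≤ ∫⁻ x, ∫⁻ y, (-logKernel x y).toENNReal + ENNReal.ofReal (separationError ρ r) ∂ν ∂μ := by
        refine lintegral_lintegral_mono_ae (hμ.mono fun x hx ↦ hν.mono fun y hy ↦ ?_)
        have hlog := abs_le.1 (abs_log_dist_sub_log_norm_le hρ (by linarith) hx hy)
        rw [toENNReal_neg_logKernel_of_one_le_dist (one_le_dist hr hx hy)]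
        exact (ENNReal.ofReal_le_ofReal (by linarith)).trans ENNReal.ofReal_add_le
    _ = _ := lintegral_lintegral_add_const _ _

theorem negEnergy_le_logMoment_add (hρ : 0 ≤ ρ) (hr : ρ + 1 ≤ r) (hμ : ∀ᵐ x ∂μ, ‖x‖ ≤ ρ)
    (hν : ∀ᵐ y ∂ν, r ≤ ‖y‖) :
    negEnergy μ ν ≤ logMoment ν + ENNReal.ofReal (separationError ρ r) := by
  calc negEnergy μ ν
      ≤ ∫⁻ _, ∫⁻ y, ENNReal.ofReal (Real.log ‖y‖) + ENNReal.ofReal (separationError ρ r) ∂ν ∂μ := by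
        refine lintegral_lintegral_mono_ae (hμ.mono fun x hx ↦ hν.mono fun y hy ↦ ?_)
        have hlog := abs_le.1 (abs_log_dist_sub_log_norm_le hρ (by linarith) hx hy)
        rw [toENNReal_neg_logKernel_of_one_le_dist (one_le_dist hr hx hy)]
        exact (ENNReal.ofReal_le_ofReal (by linarith)).trans ENNReal.ofReal_add_le
    _ = _ := by rw [lintegral_lintegral_add_const]; simp [logMoment]

end MutualEnergy

section Inversion

open EuclideanGeometry

variable {n : ℕ} {ν : Measure (EuclideanSpace ℝ (Fin n))} {y z : EuclideanSpace ℝ (Fin n)}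

@[fun_prop]
theorem measurable_inversion : Measurable (inversion (0 : EuclideanSpace ℝ (Fin n)) 1) := by
  unfold inversion
  simp only [vsub_eq_sub, sub_zero, vadd_eq_add, add_zero]
  fun_prop

theorem dist_inversion_zero_one (hy : y ≠ 0) (hz : z ≠ 0) :
    dist (inversion 0 1 y) (inversion 0 1 z) = dist y z / (‖y‖ * ‖z‖) := by
  rw [dist_inversion_inversion hy hz, dist_zero_right, dist_zero_right, one_pow, one_div_mul_eq_div]

theorem logKernel_inversion (hy : y ≠ 0) (hz : z ≠ 0) :
    logKernel (inversion 0 1 y) (inversion 0 1 z) =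
      logKernel y z + ((Real.log ‖y‖ + Real.log ‖z‖ : ℝ) : EReal) := by
  rcases eq_or_ne y z with rfl | h
  · rw [logKernel_self, logKernel_self, EReal.top_add_coe]
  · have hd := dist_pos.2 h
    have hy' := norm_pos_iff.2 hy
    have hz' := norm_pos_iff.2 hz
    have h' : inversion 0 1 y ≠ inversion 0 1 z := (inversion_injective 0 one_ne_zero).ne h
    rw [logKernel_of_ne h, logKernel_of_ne h', dist_inversion_zero_one hy hz, ← EReal.coe_add,
      Real.log_div hd.ne' (by positivity), Real.log_mul hy'.ne' hz'.ne']
    congr 1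
    ring

theorem logKernel_add_log_norm_nonneg (hy : 2 ≤ ‖y‖) (hz : 2 ≤ ‖z‖) :
    0 ≤ logKernel y z + ((Real.log ‖y‖ + Real.log ‖z‖ : ℝ) : EReal) := by
  have hy0 : y ≠ 0 := norm_pos_iff.1 (by linarith)
  have hz0 : z ≠ 0 := norm_pos_iff.1 (by linarith)
  have hdist : dist (inversion 0 1 y) (inversion 0 1 z) ≤ 1 := by
    rw [dist_inversion_zero_one hy0 hz0, div_le_one (by positivity)]
    nlinarith [dist_le_norm_add_norm y z]
  simpa [logKernel_inversion hy0 hz0] using neg_log_le_logKernel hdist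

theorem toENNReal_logKernel_inversion_add (hy : 2 ≤ ‖y‖) (hz : 2 ≤ ‖z‖) :
    (logKernel (inversion 0 1 y) (inversion 0 1 z)).toENNReal + (-logKernel y z).toENNReal =
      (logKernel y z).toENNReal +
        (ENNReal.ofReal (Real.log ‖y‖) + ENNReal.ofReal (Real.log ‖z‖)) := by
  have hlog_y : 0 ≤ Real.log ‖y‖ := Real.log_nonneg (by linarith)
  have hlog_z : 0 ≤ Real.log ‖z‖ := Real.log_nonneg (by linarith)
  have hsum := toENNReal_add_coe_add_of_nonneg (logKernel_add_log_norm_nonneg hy hz)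
  rwa [← logKernel_inversion (norm_pos_iff.1 (by linarith)) (norm_pos_iff.1 (by linarith)),
    ENNReal.ofReal_of_nonpos (by linarith), add_zero, ENNReal.ofReal_add hlog_y hlog_z] at hsum

variable [IsProbabilityMeasure ν]

theorem lintegral_lintegral_log_norm_add_log_norm :
    ∫⁻ y, ∫⁻ z, ENNReal.ofReal (Real.log ‖y‖) + ENNReal.ofReal (Real.log ‖z‖) ∂ν ∂ν =
      2 * logMoment ν := by
  rw [lintegral_lintegral_add_left (by simp only [Function.uncurry_def]; fun_prop), two_mul]
  simp [logMoment]

-- The inversion in the unit sphere turns the energy at infinity into the energy of a measure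
-- carried by a small ball, to which the equilibrium bound applies.
theorem posEnergy_map_inversion_add_negEnergy (hν : ∀ᵐ y ∂ν, 2 ≤ ‖y‖) :
    posEnergy (ν.map (inversion 0 1)) (ν.map (inversion 0 1)) + negEnergy ν ν =
      posEnergy ν ν + 2 * logMoment ν := by
  have hpush : posEnergy (ν.map (inversion 0 1)) (ν.map (inversion 0 1)) =
      ∫⁻ y, ∫⁻ z, (logKernel (inversion 0 1 y) (inversion 0 1 z)).toENNReal ∂ν ∂ν := by
    rw [posEnergy, lintegral_map (Measurable.lintegral_prod_right (by fun_prop)) (by fun_prop)]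
    exact lintegral_congr fun y ↦ lintegral_map (by fun_prop) (by fun_prop)
  rw [hpush, negEnergy, posEnergy, ← lintegral_lintegral_log_norm_add_log_norm,
    ← lintegral_lintegral_add_left (by simp only [Function.uncurry_def]; fun_prop),
    ← lintegral_lintegral_add_left (by simp only [Function.uncurry_def]; fun_prop)]
  exact lintegral_lintegral_congr_ae
    (hν.mono fun y hy ↦ hν.mono fun z hz ↦ toENNReal_logKernel_inversion_add hy hz)

theorem negEnergy_self_le_logMoment (hν : ∀ᵐ y ∂ν, 2 ≤ ‖y‖) :
    negEnergy ν ν ≤ 2 * logMoment ν := by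
  rw [← lintegral_lintegral_log_norm_add_log_norm]
  refine lintegral_lintegral_mono_ae (hν.mono fun y hy ↦ hν.mono fun z hz ↦ ?_)
  rw [← ENNReal.ofReal_add (Real.log_nonneg (by linarith)) (Real.log_nonneg (by linarith)),
    ← EReal.real_coe_toENNReal]
  refine EReal.toENNReal_le_toENNReal ?_
  rw [EReal.neg_le, ← zero_sub]
  exact EReal.sub_le_of_le_add (logKernel_add_log_norm_nonneg hy hz)

end Inversion

section OuterPlate

open EuclideanGeometry

variable {m : ℕ} {ρ r : ℝ} {μ ν : Measure (EuclideanSpace ℝ (Fin (m + 2)))}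
  [IsProbabilityMeasure ν]

theorem coe_toReal_of_ne_top {a : ℝ≥0∞} (ha : a ≠ ⊤) : ((a.toReal : ℝ) : EReal) = a := by
  lift a to NNReal using ha
  rfl

theorem ballRobin_add_log_le_posEnergy (hr : 2 ≤ r) (hν : ∀ᵐ y ∂ν, r ≤ ‖y‖) :
    ((ballRobin m + Real.log r : ℝ) : EReal) ≤
      (posEnergy (ν.map (inversion 0 1)) (ν.map (inversion 0 1)) : EReal) := by
  have : IsProbabilityMeasure (ν.map (inversion 0 1)) :=
    Measure.isProbabilityMeasure_map (by fun_prop)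
  have hr0 : 0 < r := by linarith
  have hsmall : ∀ᵐ y ∂ν.map (inversion 0 1), ‖y‖ ≤ r⁻¹ := by
    rw [ae_map_iff (by fun_prop) (measurableSet_le measurable_norm measurable_const)]
    filter_upwards [hν] with y hy
    rw [← dist_zero_right, dist_inversion_center, dist_zero_right, one_pow, one_div]
    exact inv_anti₀ hr0 hy
  have hrobin := le_logEnergy_of_ae_norm_le (inv_pos.2 hr0) hsmall
  rw [Real.log_inv, sub_neg_eq_add] at hrobin
  exact hrobin.trans
    (EReal.sub_le_of_le_add (le_add_of_nonneg_right (EReal.coe_ennreal_nonneg _)))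

theorem ballRobin_add_log_le_toReal_add_logMoment (hr : 2 ≤ r) (hν : ∀ᵐ y ∂ν, r ≤ ‖y‖)
    (hpos : posEnergy ν ν ≠ ⊤) (hmoment : logMoment ν ≠ ⊤) :
    ballRobin m + Real.log r ≤
      (posEnergy ν ν).toReal - (negEnergy ν ν).toReal + 2 * (logMoment ν).toReal := by
  have hν2 : ∀ᵐ y ∂ν, 2 ≤ ‖y‖ := hν.mono fun y ↦ hr.trans
  have hsum := posEnergy_map_inversion_add_negEnergy hν2
  have hfinite := ENNReal.add_ne_top.1 (hsum.trans_ne (by finiteness))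
  have hrobin := ballRobin_add_log_le_posEnergy hr hν
  rw [← coe_toReal_of_ne_top hfinite.1, EReal.coe_le_coe_iff] at hrobin
  have hsum_real := congrArg ENNReal.toReal hsum
  rw [ENNReal.toReal_add hfinite.1 hfinite.2, ENNReal.toReal_add hpos (by finiteness),
    ENNReal.toReal_mul, ENNReal.toReal_ofNat] at hsum_real
  linarith

theorem negEnergy_self_ne_top (hν : ∀ᵐ y ∂ν, 2 ≤ ‖y‖) (hmoment : logMoment ν ≠ ⊤) :
    negEnergy ν ν ≠ ⊤ :=
  ne_top_of_le_ne_top (by finiteness) (negEnergy_self_le_logMoment hν)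

variable [IsProbabilityMeasure μ]

theorem logMoment_ne_top (hρ : 0 ≤ ρ) (hr : ρ + 1 ≤ r) (hμ : ∀ᵐ x ∂μ, ‖x‖ ≤ ρ)
    (hν : ∀ᵐ y ∂ν, r ≤ ‖y‖) (hμν : negEnergy μ ν ≠ ⊤) : logMoment ν ≠ ⊤ :=
  ne_top_of_le_ne_top (by finiteness) (logMoment_le_negEnergy_add hρ hr hμ hν)

theorem ballRobin_add_log_le_toReal_add_negEnergy (hρ : 0 ≤ ρ) (hr : ρ + 1 ≤ r) (hr2 : 2 ≤ r)
    (hμ : ∀ᵐ x ∂μ, ‖x‖ ≤ ρ) (hν : ∀ᵐ y ∂ν, r ≤ ‖y‖) (hpos : posEnergy ν ν ≠ ⊤)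
    (hμν : negEnergy μ ν ≠ ⊤) :
    ballRobin m + Real.log r - 2 * separationError ρ r ≤
      (posEnergy ν ν).toReal - (negEnergy ν ν).toReal + 2 * (negEnergy μ ν).toReal := by
  have hmoment := ENNReal.toReal_mono (by finiteness) (logMoment_le_negEnergy_add hρ hr hμ hν)
  rw [ENNReal.toReal_add hμν (by finiteness),
    ENNReal.toReal_ofReal (separationError_nonneg hρ (by linarith))] at hmoment
  linarith [ballRobin_add_log_le_toReal_add_logMoment hr2 hν hpos
    (logMoment_ne_top hρ hr hμ hν hμν)]

end OuterPlate

section Charge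

variable {n : ℕ} {K : Set (EuclideanSpace ℝ (Fin n))} {ρ r : ℝ}
  {μ ν : Measure (EuclideanSpace ℝ (Fin n))}

theorem add_sub_add_eq_sub_add_toReal (a : ℝ≥0∞) {b c d e : ℝ≥0∞} (hb : b ≠ ⊤) (hc : c ≠ ⊤)
    (hd : d ≠ ⊤) (he : e ≠ ⊤) :
    ((a + c + e + e : ℝ≥0∞) : EReal) - ((b + d : ℝ≥0∞) : EReal) =
      (a : EReal) - (b : EReal) + ((c.toReal - d.toReal + 2 * e.toReal : ℝ) : EReal) := by
  lift b to NNReal using hb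
  lift c to NNReal using hc
  lift d to NNReal using hd
  lift e to NNReal using he
  rcases eq_or_ne a ⊤ with rfl | ha
  · rfl
  lift a to NNReal using ha
  change (((a + c + e + e : ℝ) : EReal)) - ((b + d : ℝ) : EReal) =
    ((a : ℝ) : EReal) - ((b : ℝ) : EReal) + ((c - d + 2 * e : ℝ) : EReal)
  norm_cast
  push_cast
  ring

theorem signedPos_sub_signedNeg_eq [SFinite μ] [SFinite ν] (hfar : posEnergy μ ν = 0)
    (hμ : negEnergy μ μ ≠ ⊤) (hν : posEnergy ν ν ≠ ⊤) (hν' : negEnergy ν ν ≠ ⊤)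
    (hμν : negEnergy μ ν ≠ ⊤) :
    (signedPos μ ν : EReal) - (signedNeg μ ν : EReal) = logEnergy μ +
      (((posEnergy ν ν).toReal - (negEnergy ν ν).toReal + 2 * (negEnergy μ ν).toReal : ℝ) :
        EReal) := by
  rw [signedPos, signedNeg, posEnergy_comm ν μ, negEnergy_comm ν μ, hfar, add_zero, add_zero,
    add_sub_add_eq_sub_add_toReal _ hμ hν hν' hμν, logEnergy]

theorem ae_norm_le_of_measure_compl_eq_zero (hK : K ⊆ closedBall 0 ρ) (hμ : μ Kᶜ = 0) :
    ∀ᵐ x ∂μ, ‖x‖ ≤ ρ :=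
  measure_compl_closedBall_eq_zero_iff.1 (measure_mono_null (compl_subset_compl.2 hK) hμ)

theorem measure_ball_eq_zero_iff_ae : μ (ball 0 r) = 0 ↔ ∀ᵐ y ∂μ, r ≤ ‖y‖ := by
  simp only [ae_iff, not_le, ← mem_ball_zero_iff, Set.ofPred_mem_eq]

theorem negEnergy_self_ne_top_of_ae_norm_le [IsProbabilityMeasure μ] (hμ : ∀ᵐ x ∂μ, ‖x‖ ≤ ρ) :
    negEnergy μ μ ≠ ⊤ :=
  ne_top_of_le_ne_top ENNReal.ofReal_ne_top
    (negEnergy_le_of_dist_le (ae_dist_le_of_ae_norm_le hμ hμ))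

theorem nrob_le_logEnergy [IsProbabilityMeasure μ] (hμ : μ Kᶜ = 0) : nrob K ≤ logEnergy μ :=
  iInf₂_le_of_le μ inferInstance (iInf_le _ hμ)

end Charge

section LowerBound

variable {m : ℕ} {K : Set (EuclideanSpace ℝ (Fin (m + 2)))} {ρ r : ℝ}
  {μ ν : Measure (EuclideanSpace ℝ (Fin (m + 2)))}

theorem nrob_add_le_signedPos_sub_signedNeg (hρ : 0 ≤ ρ) (hK : K ⊆ closedBall 0 ρ)
    (hr : ρ + 1 ≤ r) (hr2 : 2 ≤ r) (h : IsCharge (ball 0 r) K μ ν) :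
    nrob K + ((ballRobin m + Real.log r - 2 * separationError ρ r : ℝ) : EReal) ≤
      (signedPos μ ν : EReal) - (signedNeg μ ν : EReal) := by
  have := h.prob_inner
  have := h.prob_outer
  have hμ := ae_norm_le_of_measure_compl_eq_zero hK h.carried_inner
  have hν := measure_ball_eq_zero_iff_ae.1 h.carried_outer
  rcases eq_or_ne (signedPos μ ν) ⊤ with htop | hfinite
  · rw [htop, ← coe_toReal_of_ne_top (h.defined.resolve_left (not_not.2 htop))]
    exact le_top
  · rw [signedPos] at hfinite
    simp only [ENNReal.add_ne_top] at hfinite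
    obtain ⟨⟨⟨-, hνν⟩, hμν⟩, -⟩ := hfinite
    have hneg := negEnergy_self_ne_top (hν.mono fun y ↦ hr2.trans)
      (logMoment_ne_top hρ hr hμ hν hμν)
    rw [signedPos_sub_signedNeg_eq (posEnergy_eq_zero hr hμ hν)
      (negEnergy_self_ne_top_of_ae_norm_le hμ) hνν hneg hμν]
    exact add_le_add (nrob_le_logEnergy h.carried_inner) (EReal.coe_le_coe_iff.2
      (ballRobin_add_log_le_toReal_add_negEnergy hρ hr hr2 hμ hν hνν hμν))

theorem nrob_add_le_nmd (hρ : 0 ≤ ρ) (hK : K ⊆ closedBall 0 ρ) (hr : ρ + 1 ≤ r) (hr2 : 2 ≤ r) :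
    nrob K + ((ballRobin m + Real.log r - 2 * separationError ρ r : ℝ) : EReal) ≤
      nmd (ball 0 r) K :=
  le_iInf₂ fun _ _ ↦ le_iInf (nrob_add_le_signedPos_sub_signedNeg hρ hK hr hr2)

end LowerBound

section UpperBound

variable {m n : ℕ} {ρ r : ℝ}

theorem logMoment_sphereMeasure (hn : n ≠ 0) (hr : 0 < r) :
    logMoment (sphereMeasure n r) = ENNReal.ofReal (Real.log r) := by
  calc _ = ∫⁻ _, ENNReal.ofReal (Real.log r) ∂sphereMeasure n r :=
        lintegral_congr_ae ((ae_norm_eq_sphereMeasure hn hr).mono fun y hy ↦ by simp only [hy])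
    _ = _ := by simp

theorem ne_top_and_toReal_sub_toReal_eq {c d : ℝ≥0∞} {s : ℝ} (hd : d ≠ ⊤)
    (h : (c : EReal) - (d : EReal) = s) : c ≠ ⊤ ∧ c.toReal - d.toReal = s := by
  rw [← coe_toReal_of_ne_top hd] at h
  have hc : c ≠ ⊤ := by
    rintro rfl
    exact EReal.coe_ne_top s h.symm
  rw [← coe_toReal_of_ne_top hc] at h
  exact ⟨hc, by exact_mod_cast h⟩

theorem negEnergy_sphereMeasure_ne_top (hn : n ≠ 0) (hr : 0 < r) :
    negEnergy (sphereMeasure n r) (sphereMeasure n r) ≠ ⊤ :=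
  negEnergy_self_ne_top_of_ae_norm_le ((ae_norm_eq_sphereMeasure hn hr).mono fun _ ↦ le_of_eq)

theorem toReal_energies_sphereMeasure (m : ℕ) (hr : 0 < r) :
    posEnergy (sphereMeasure (m + 2) r) (sphereMeasure (m + 2) r) ≠ ⊤ ∧
      (posEnergy (sphereMeasure (m + 2) r) (sphereMeasure (m + 2) r)).toReal -
        (negEnergy (sphereMeasure (m + 2) r) (sphereMeasure (m + 2) r)).toReal =
          ballRobin m - Real.log r :=
  ne_top_and_toReal_sub_toReal_eq (negEnergy_sphereMeasure_ne_top (Nat.succ_ne_zero _) hr)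
    (logEnergy_sphereMeasure m hr)

variable {K : Set (EuclideanSpace ℝ (Fin n))} {μ : Measure (EuclideanSpace ℝ (Fin n))}
  [IsProbabilityMeasure μ]

theorem negEnergy_sphereMeasure_le (hn : n ≠ 0) (hρ : 0 ≤ ρ) (hr : ρ + 1 ≤ r)
    (hμ : ∀ᵐ x ∂μ, ‖x‖ ≤ ρ) :
    negEnergy μ (sphereMeasure n r) ≤ ENNReal.ofReal (Real.log r + separationError ρ r) := by
  have hr0 : 0 < r := by linarith
  have hsphere : ∀ᵐ y ∂sphereMeasure n r, r ≤ ‖y‖ :=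
    (ae_norm_eq_sphereMeasure hn hr0).mono fun _ ↦ ge_of_eq
  rw [ENNReal.ofReal_add (Real.log_nonneg (by linarith))
    (separationError_nonneg hρ (by linarith)), ← logMoment_sphereMeasure hn hr0]
  exact negEnergy_le_logMoment_add hρ hr hμ hsphere

theorem isCharge_sphereMeasure (hn : n ≠ 0) (hρ : 0 ≤ ρ) (hK : K ⊆ closedBall 0 ρ)
    (hr : ρ + 1 ≤ r) (hμ : μ Kᶜ = 0) : IsCharge (ball 0 r) K μ (sphereMeasure n r) := by
  have hr0 : 0 < r := by linarith
  have hsphere : ∀ᵐ y ∂sphereMeasure n r, r ≤ ‖y‖ :=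
    (ae_norm_eq_sphereMeasure hn hr0).mono fun _ ↦ ge_of_eq
  have hinner := ae_norm_le_of_measure_compl_eq_zero hK hμ
  refine ⟨inferInstance, inferInstance, hμ, measure_ball_eq_zero_iff_ae.2 hsphere, Or.inr ?_⟩
  have hnegμ := negEnergy_self_ne_top_of_ae_norm_le hinner
  have hnegν := negEnergy_sphereMeasure_ne_top hn hr0
  rw [signedNeg, posEnergy_comm (sphereMeasure n r) μ, posEnergy_eq_zero hr hinner hsphere]
  finiteness

end UpperBound

section Limit

variable {m : ℕ} {K : Set (EuclideanSpace ℝ (Fin (m + 2)))} {ρ r : ℝ}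

theorem nmd_le_logEnergy_add (hρ : 0 ≤ ρ) (hK : K ⊆ closedBall 0 ρ) (hr : ρ + 1 ≤ r)
    {μ : Measure (EuclideanSpace ℝ (Fin (m + 2)))} [IsProbabilityMeasure μ] (hμ : μ Kᶜ = 0) :
    nmd (ball 0 r) K ≤ logEnergy μ +
      ((ballRobin m + Real.log r + 2 * separationError ρ r : ℝ) : EReal) := by
  have hr0 : 0 < r := by linarith
  have hn : m + 2 ≠ 0 := Nat.succ_ne_zero _
  have hinner := ae_norm_le_of_measure_compl_eq_zero hK hμ
  have hsphere : ∀ᵐ y ∂sphereMeasure (m + 2) r, r ≤ ‖y‖ :=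
    (ae_norm_eq_sphereMeasure hn hr0).mono fun _ ↦ ge_of_eq
  have hmutual := negEnergy_sphereMeasure_le hn hρ hr hinner
  have hmutual_real : (negEnergy μ (sphereMeasure (m + 2) r)).toReal ≤
      Real.log r + separationError ρ r :=
    ENNReal.toReal_le_of_le_ofReal (add_nonneg (Real.log_nonneg (by linarith))
      (separationError_nonneg hρ (by linarith))) hmutual
  obtain ⟨hpos, hself⟩ := toReal_energies_sphereMeasure m hr0
  calc nmd (ball 0 r) K
      ≤ (signedPos μ (sphereMeasure (m + 2) r) : EReal) -
          (signedNeg μ (sphereMeasure (m + 2) r) : EReal) :=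
        iInf₂_le_of_le _ _ (iInf_le _ (isCharge_sphereMeasure hn hρ hK hr hμ))
    _ ≤ _ := by
        rw [signedPos_sub_signedNeg_eq (posEnergy_eq_zero hr hinner hsphere)
          (negEnergy_self_ne_top_of_ae_norm_le hinner) hpos
          (negEnergy_sphereMeasure_ne_top hn hr0)
          (ne_top_of_le_ne_top ENNReal.ofReal_ne_top hmutual), hself]
        refine add_le_add le_rfl (EReal.coe_le_coe_iff.2 ?_)
        linarith

theorem nmd_le_nrob_add (hρ : 0 ≤ ρ) (hK : K ⊆ closedBall 0 ρ) (hr : ρ + 1 ≤ r) :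
    nmd (ball 0 r) K ≤
      nrob K + ((ballRobin m + Real.log r + 2 * separationError ρ r : ℝ) : EReal) := by
  rw [← EReal.sub_le_iff_le_add (Or.inl (EReal.coe_ne_bot _)) (Or.inl (EReal.coe_ne_top _))]
  refine le_iInf₂ fun μ _ ↦ le_iInf fun hμ ↦ ?_
  rw [EReal.sub_le_iff_le_add (Or.inl (EReal.coe_ne_bot _)) (Or.inl (EReal.coe_ne_top _))]
  exact nmd_le_logEnergy_add hρ hK hr hμ

theorem tendsto_add_mul_separationError (A : EReal) (b s ρ : ℝ) :
    Tendsto (fun r ↦ A + ((b + s * separationError ρ r : ℝ) : EReal)) atTop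
      (𝓝 (A + (b : EReal))) := by
  have hreal : Tendsto (fun r ↦ b + s * separationError ρ r) atTop (𝓝 b) := by
    simpa using ((tendsto_separationError ρ).const_mul s).const_add b
  exact (EReal.continuousAt_add (p := (A, (b : EReal))) (Or.inr (EReal.coe_ne_bot _))
    (Or.inr (EReal.coe_ne_top _))).tendsto.comp (tendsto_const_nhds.prodMk_nhds
      ((continuous_coe_real_ereal.tendsto _).comp hreal))

theorem add_coe_add_add_sub_coe (A : EReal) (a b l : ℝ) :
    A + ((a + l + b : ℝ) : EReal) - (l : EReal) = A + ((a + b : ℝ) : EReal) := by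
  rw [sub_eq_add_neg, add_assoc, ← EReal.coe_neg, ← EReal.coe_add]
  congr 2
  ring

theorem tendsto_nmd_sub_log (hK : Bornology.IsBounded K) :
    Tendsto (fun r : ℝ ↦ nmd (ball (0 : EuclideanSpace ℝ (Fin (m + 2))) r) K - (Real.log r : EReal))
      atTop (𝓝 (nrob K + (ballRobin m : EReal))) := by
  obtain ⟨ρ, hρ, hKρ⟩ := hK.subset_closedBall_lt 0 0
  refine tendsto_of_tendsto_of_tendsto_of_le_of_le'
    (tendsto_add_mul_separationError (nrob K) (ballRobin m) (-2) ρ)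
    (tendsto_add_mul_separationError (nrob K) (ballRobin m) 2 ρ) ?_ ?_
  · filter_upwards [eventually_ge_atTop (ρ + 1), eventually_ge_atTop 2] with r hr hr2
    rw [← add_coe_add_add_sub_coe _ _ _ (Real.log r), neg_mul, ← sub_eq_add_neg (_ + _)]
    exact EReal.sub_le_sub (nrob_add_le_nmd hρ.le hKρ hr hr2) le_rfl
  · filter_upwards [eventually_ge_atTop (ρ + 1)] with r hr
    rw [← add_coe_add_add_sub_coe _ _ _ (Real.log r)]
    exact EReal.sub_le_sub (nmd_le_nrob_add hρ.le hKρ hr) le_rfl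

theorem ncap3_eq_exp_div (K : Set (EuclideanSpace ℝ (Fin (m + 2)))) :
    ncap3 K = EReal.exp (-(nrob K + (ballRobin m : EReal))) /
      ncap3 (closedBall (0 : EuclideanSpace ℝ (Fin (m + 2))) 1) := by
  rw [ncap3_closedBall m one_pos, one_mul, EReal.neg_add (Or.inr (EReal.coe_ne_top _))
    (Or.inr (EReal.coe_ne_bot _)), sub_eq_add_neg, EReal.exp_add, ← EReal.coe_neg, EReal.exp_coe,
    ENNReal.mul_div_cancel_right (by simp [Real.exp_pos]) ENNReal.ofReal_ne_top, ncap3]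

end Limit

/-! ### Functions absolutely continuous on lines -/

section Lines

variable {n : ℕ} {f g : EuclideanSpace ℝ (Fin n) → ℝ}

/-- The gradient formed from the partial derivatives alone, so that it makes sense almost everywhere
for functions absolutely continuous on lines; `gradNorm` is its norm. -/
noncomputable def partialGrad (f : EuclideanSpace ℝ (Fin n) → ℝ) (x : EuclideanSpace ℝ (Fin n)) :
    EuclideanSpace ℝ (Fin n) :=
  WithLp.toLp 2 fun i ↦ lineDeriv ℝ f x (EuclideanSpace.single i 1)

theorem gradNorm_eq_norm_partialGrad : gradNorm f = fun x ↦ ‖partialGrad f x‖ := by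
  ext x
  simp [gradNorm, partialGrad, EuclideanSpace.norm_eq]

theorem measurable_partialGrad (hf : Continuous f) : Measurable (partialGrad f) :=
  (PiLp.continuous_toLp 2 _).measurable.comp
    (measurable_pi_iff.2 fun _ ↦ measurable_lineDeriv hf)

theorem partialGrad_congr {x : EuclideanSpace ℝ (Fin n)} (h : f =ᶠ[𝓝 x] g) :
    partialGrad f x = partialGrad g x := by
  ext i
  exact h.lineDeriv_eq

theorem partialGrad_const (c : ℝ) (x : EuclideanSpace ℝ (Fin n)) :
    partialGrad (fun _ ↦ c) x = 0 := by
  ext i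
  simp [partialGrad, lineDeriv]

theorem partialGrad_const_sub (c : ℝ) (f : EuclideanSpace ℝ (Fin n) → ℝ)
    (x : EuclideanSpace ℝ (Fin n)) : partialGrad (fun x ↦ c - f x) x = -partialGrad f x := by
  ext i
  simp [partialGrad, lineDeriv]

theorem linePoint_add (i : Fin n) (y : {j : Fin n // j ≠ i} → ℝ) (t s : ℝ) :
    linePoint i y (t + s) = linePoint i y t + s • EuclideanSpace.single i 1 := by
  ext j
  rcases eq_or_ne j i with rfl | h
  · simp [linePoint]
  · simp [linePoint, h]

theorem isometry_linePoint (i : Fin n) (y : {j : Fin n // j ≠ i} → ℝ) :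
    Isometry (linePoint i y) := by
  refine Isometry.of_dist_eq fun s t ↦ ?_
  rw [← add_sub_cancel t s, linePoint_add, dist_self_add_left, norm_smul]
  simp [Real.dist_eq]

theorem partialGrad_linePoint (f : EuclideanSpace ℝ (Fin n) → ℝ) (i : Fin n)
    (y : {j : Fin n // j ≠ i} → ℝ) (t : ℝ) :
    partialGrad f (linePoint i y t) i = deriv (fun t ↦ f (linePoint i y t)) t := by
  simp only [partialGrad, lineDeriv, ← linePoint_add]
  simpa using deriv_comp_const_add (f := fun t ↦ f (linePoint i y t)) t 0

theorem isACL_of_lipschitzWith {C : NNReal} (hf : LipschitzWith C f) : IsACL f := fun i ↦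
  ae_of_all _ fun y _ _ ↦
    (hf.comp (isometry_linePoint i y).lipschitz).lipschitzOnWith.absolutelyContinuousOnInterval

theorem IsACL.sub (hf : IsACL f) (hg : IsACL g) : IsACL fun x ↦ f x - g x := fun i ↦ by
  filter_upwards [hf i, hg i] with y hfy hgy a b using (hfy a b).sub (hgy a b)

theorem IsACL.mul (hf : IsACL f) (hg : IsACL g) : IsACL fun x ↦ f x * g x := fun i ↦ by
  filter_upwards [hf i, hg i] with y hfy hgy a b using (hfy a b).mul (hgy a b)

theorem isACL_const (c : ℝ) : IsACL fun _ : EuclideanSpace ℝ (Fin n) ↦ c :=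
  isACL_of_lipschitzWith (LipschitzWith.const c)

theorem IsACL.pow (hf : IsACL f) (k : ℕ) : IsACL fun x ↦ f x ^ k := by
  induction k with
  | zero => simpa only [pow_zero] using isACL_const 1
  | succ k ih => simpa only [pow_succ] using ih.mul hf

theorem measurePreserving_linePoint (i : Fin n) :
    MeasurePreserving (fun p : ℝ × ({j : Fin n // j ≠ i} → ℝ) ↦ linePoint i p.2 p.1)
      volume volume := by
  have split_coordinate : MeasurePreserving
      (MeasurableEquiv.funUnique {j : Fin n // j = i} ℝ).symm volume volume := by
    convert! (volume_preserving_funUnique {j : Fin n // j = i} ℝ).symm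
  have merge : MeasurePreserving
      (MeasurableEquiv.piEquivPiSubtypeProd (fun _ : Fin n ↦ ℝ) (fun j ↦ j = i)).symm
      (volume.prod volume) volume := by
    convert! (volume_preserving_piEquivPiSubtypeProd (fun _ : Fin n ↦ ℝ) (fun j ↦ j = i)).symm
    rw [Measure.volume_eq_prod]
    congr!
  convert! (PiLp.volume_preserving_toLp (Fin n)).comp (merge.comp
    (split_coordinate.prod (MeasurePreserving.id (volume : Measure ({j : Fin n // ¬ j = i} → ℝ)))))
    using 1

theorem integral_eq_integral_lines (i : Fin n) (hf : Integrable f) :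
    ∫ x, f x = ∫ y : ({j : Fin n // j ≠ i} → ℝ), ∫ t : ℝ, f (linePoint i y t) := by
  have hmp := measurePreserving_linePoint i
  rw [← hmp.map_eq, integral_map hmp.measurable.aemeasurable
    (hmp.map_eq.symm ▸ hf.aestronglyMeasurable), Measure.volume_eq_prod]
  exact integral_prod_symm _ ((hmp.integrable_comp hf.aestronglyMeasurable).2 hf)

theorem integral_mul_deriv_eq_neg_of_absolutelyContinuous {f g : ℝ → ℝ}
    (hf : ∀ a b, AbsolutelyContinuousOnInterval f a b)
    (hg : ∀ a b, AbsolutelyContinuousOnInterval g a b) (hsupp : HasCompactSupport f) :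
    ∫ t, f t * deriv g t = -∫ t, deriv f t * g t := by
  obtain ⟨R, -, hR⟩ := hsupp.isCompact.isBounded.subset_ball_lt 0 0
  rw [Real.ball_eq_Ioo, zero_sub, zero_add] at hR
  have hzero : ∀ t ∉ Ioo (-R) R, f t = 0 := fun t ht ↦
    image_eq_zero_of_notMem_tsupport fun h ↦ ht (hR h)
  have integral_eq : ∀ F : ℝ → ℝ, Function.support F ⊆ tsupport f →
      ∫ t, F t = ∫ t in (-R)..R, F t := fun F hF ↦
    (intervalIntegral.integral_eq_integral_of_support_subset
      ((hF.trans hR).trans Ioo_subset_Ioc_self)).symm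
  rw [integral_eq _ ((Function.support_mul_subset_left _ _).trans (subset_tsupport f)),
    integral_eq _ ((Function.support_mul_subset_left _ _).trans support_deriv_subset),
    (hf _ _).integral_mul_deriv_eq_deriv_mul (hg _ _), hzero R (by simp), hzero (-R) (by simp)]
  simp

theorem integral_mul_partialGrad_eq_neg (i : Fin n) (hf : IsACL f) (hg : IsACL g)
    (hsupp : HasCompactSupport f) (hfg : Integrable fun x ↦ f x * partialGrad g x i)
    (hfg' : Integrable fun x ↦ partialGrad f x i * g x) :
    ∫ x, f x * partialGrad g x i = -∫ x, partialGrad f x i * g x := by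
  rw [integral_eq_integral_lines i hfg, integral_eq_integral_lines i hfg', ← integral_neg]
  refine integral_congr_ae ?_
  filter_upwards [hf i, hg i] with y hfy hgy
  simp only [partialGrad_linePoint]
  exact integral_mul_deriv_eq_neg_of_absolutelyContinuous hfy hgy
    (hsupp.comp_isClosedEmbedding (isometry_linePoint i y).isClosedEmbedding)

end Lines

/-! ### The radial field -/

section RadialField

variable {n : ℕ} {r : ℝ} {x : EuclideanSpace ℝ (Fin n)}

theorem hasLineDerivAt_norm (hx : x ≠ 0) (i : Fin n) :
    HasLineDerivAt ℝ norm (x i / ‖x‖) x (EuclideanSpace.single i (1 : ℝ)) := by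
  have hline : HasDerivAt (fun t : ℝ ↦ x + t • EuclideanSpace.single i (1 : ℝ))
      (EuclideanSpace.single i (1 : ℝ)) 0 := by
    simpa using ((hasDerivAt_id (0 : ℝ)).smul_const (EuclideanSpace.single i (1 : ℝ))).const_add x
  have hnorm := hline.norm_sq.sqrt (by simpa using hx)
  simp only [zero_smul, add_zero, Real.sqrt_sq (norm_nonneg _)] at hnorm
  refine hnorm.congr_deriv ?_
  rw [EuclideanSpace.inner_single_right, mul_div_mul_left _ _ two_ne_zero]
  simp

theorem abs_max_norm_sub_max_norm_le {E : Type*} [SeminormedAddCommGroup E] (r : ℝ) (x y : E) :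
    |max ‖x‖ r - max ‖y‖ r| ≤ dist x y := by
  refine (abs_max_sub_max_le_abs _ _ _).trans ?_
  rw [dist_eq_norm]
  exact abs_norm_sub_norm_le x y

theorem lipschitzWith_inv_max_norm {E : Type*} [SeminormedAddCommGroup E] (hr : 0 < r) :
    LipschitzWith (Real.toNNReal (r ^ 2)⁻¹) fun x : E ↦ (max ‖x‖ r)⁻¹ := by
  refine LipschitzWith.of_dist_le_mul fun x y ↦ ?_
  have hx : r ≤ max ‖x‖ r := le_max_right _ _
  have hy : r ≤ max ‖y‖ r := le_max_right _ _
  rw [Real.coe_toNNReal _ (by positivity), Real.dist_eq,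
    inv_sub_inv (hr.trans_le hx).ne' (hr.trans_le hy).ne', abs_div,
    abs_of_pos (mul_pos (hr.trans_le hx) (hr.trans_le hy)), inv_mul_eq_div, dist_comm, sq]
  gcongr
  exact abs_max_norm_sub_max_norm_le r y x

/-- The field `x / |x|ⁿ`, which is divergence free, continued inside the ball of radius `r` by the
linear field `x / rⁿ`, of constant divergence. -/
noncomputable def radialField (r : ℝ) (x : EuclideanSpace ℝ (Fin n)) : EuclideanSpace ℝ (Fin n) :=
  (max ‖x‖ r)⁻¹ ^ n • x

theorem radialField_of_norm_le (hx : ‖x‖ ≤ r) : radialField r x = r⁻¹ ^ n • x := by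
  rw [radialField, max_eq_right hx]

theorem radialField_of_le_norm (hx : r ≤ ‖x‖) : radialField r x = ‖x‖⁻¹ ^ n • x := by
  rw [radialField, max_eq_left hx]

theorem continuous_radialField (hr : 0 < r) :
    Continuous (radialField r : EuclideanSpace ℝ (Fin n) → EuclideanSpace ℝ (Fin n)) :=
  ((lipschitzWith_inv_max_norm hr).continuous.pow n).smul continuous_id

theorem isACL_radialField (hr : 0 < r) (i : Fin n) :
    IsACL fun x : EuclideanSpace ℝ (Fin n) ↦ radialField r x i :=
  ((isACL_of_lipschitzWith (lipschitzWith_inv_max_norm hr)).pow n).mul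
    (isACL_of_lipschitzWith (EuclideanSpace.proj (𝕜 := ℝ) i).lipschitz)

theorem partialGrad_radialField_of_norm_lt (hx : ‖x‖ < r) (i : Fin n) :
    partialGrad (fun x ↦ radialField r x i) x i = r⁻¹ ^ n := by
  have heq : (fun x ↦ radialField r x i) =ᶠ[𝓝 x] fun x ↦ r⁻¹ ^ n * x i := by
    filter_upwards [continuous_norm.continuousAt.eventually_lt_const hx] with z hz
    rw [radialField_of_norm_le hz.le, PiLp.smul_apply, smul_eq_mul]
  rw [partialGrad_congr heq]
  simp [partialGrad, lineDeriv]

theorem partialGrad_radialField_of_lt_norm (hr : 0 < r) (hx : r < ‖x‖) (i : Fin n) :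
    partialGrad (fun x ↦ radialField r x i) x i = ‖x‖⁻¹ ^ n * (1 - n * (x i ^ 2 / ‖x‖ ^ 2)) := by
  have hx0 : 0 < ‖x‖ := hr.trans hx
  have heq : (fun x ↦ radialField r x i) =ᶠ[𝓝 x] fun x ↦ ‖x‖⁻¹ ^ n * x i := by
    filter_upwards [continuous_norm.continuousAt.eventually_const_lt hx] with z hz
    rw [radialField_of_le_norm hz.le, PiLp.smul_apply, smul_eq_mul]
  rw [partialGrad_congr heq]
  have hnorm := (hasLineDerivAt_norm (norm_pos_iff.1 hx0) i).inv (by simpa using hx0.ne')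
  have hderiv := ((hnorm.pow n).mul ((hasDerivAt_id (0 : ℝ)).const_add (x i))).deriv
  obtain ⟨k, rfl⟩ : ∃ k, n = k + 1 := Nat.exists_eq_succ_of_ne_zero (i.pos).ne'
  simp only [partialGrad, lineDeriv, PiLp.add_apply, PiLp.smul_apply, PiLp.single_apply,
    if_true, smul_eq_mul, mul_one]
  refine hderiv.trans ?_
  simp
  field_simp
  ring

theorem sum_sq_apply (x : EuclideanSpace ℝ (Fin n)) : ∑ i, x i ^ 2 = ‖x‖ ^ 2 := by
  simp [EuclideanSpace.norm_sq_eq]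

theorem sum_partialGrad_radialField (hr : 0 < r) (hx : ‖x‖ ≠ r) :
    ∑ i, partialGrad (fun x ↦ radialField r x i) x i =
      (ball 0 r).indicator (fun _ ↦ n * r⁻¹ ^ n) x := by
  rcases lt_or_gt_of_ne hx with h | h
  · simp [partialGrad_radialField_of_norm_lt h, h]
  · have hx0 : ‖x‖ ^ 2 ≠ 0 := (pow_pos (hr.trans h) 2).ne'
    simp only [partialGrad_radialField_of_lt_norm hr h]
    rw [← Finset.mul_sum, Finset.sum_sub_distrib, ← Finset.mul_sum, ← Finset.sum_div, sum_sq_apply,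
      div_self hx0, indicator_of_notMem (by simpa using h.le)]
    simp

theorem norm_partialGrad_radialField_le (hr : 0 < r) (hx : ‖x‖ ≠ r) (i : Fin n) :
    ‖partialGrad (fun x ↦ radialField r x i) x i‖ ≤ r⁻¹ ^ n * (1 + n) := by
  rcases lt_or_gt_of_ne hx with h | h
  · rw [partialGrad_radialField_of_norm_lt h, Real.norm_of_nonneg (by positivity)]
    exact le_mul_of_one_le_right (by positivity) (by simp)
  · have hx0 : 0 < ‖x‖ := hr.trans h
    have hxi : x i ^ 2 / ‖x‖ ^ 2 ≤ 1 := by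
      rw [div_le_one (by positivity), sq_le_sq, abs_norm]
      simpa using PiLp.norm_apply_le x i
    have hxi0 : 0 ≤ x i ^ 2 / ‖x‖ ^ 2 := by positivity
    rw [partialGrad_radialField_of_lt_norm hr h, norm_mul, Real.norm_of_nonneg (by positivity)]
    gcongr
    rw [Real.norm_eq_abs, abs_le]
    constructor <;> nlinarith [(Nat.cast_nonneg n : (0 : ℝ) ≤ n)]

end RadialField

/-! ### Conformal capacity of spherical rings -/

section LowerBound

variable {n : ℕ} {O K : Set (EuclideanSpace ℝ (Fin n))} {u : EuclideanSpace ℝ (Fin n) → ℝ}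
  {r R : ℝ}

theorem natCast_mul_volume_unitBall (hn : 2 ≤ n) :
    n * volume (ball (0 : EuclideanSpace ℝ (Fin n)) 1) =
      ENNReal.ofReal (sphereArea (n - 1)) := by
  have : Nonempty (Fin n) := ⟨⟨0, by lia⟩⟩
  have hΓ : Real.Gamma ((n : ℝ) / 2) ≠ 0 := (Real.Gamma_pos_of_pos (by positivity)).ne'
  rw [EuclideanSpace.volume_ball, ENNReal.ofReal_one, one_pow, one_mul, Fintype.card_fin,
    ← ENNReal.ofReal_natCast, ← ENNReal.ofReal_mul (by positivity), sphereArea,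
    if_neg (by lia : n - 1 ≠ 0), Nat.cast_sub (by lia), Nat.cast_one, sub_add_cancel,
    Real.Gamma_add_one (by positivity), Real.sqrt_eq_rpow, ← Real.rpow_natCast,
    ← Real.rpow_mul Real.pi_pos.le, one_div_mul_eq_div]
  congr 1
  field_simp

theorem sphereArea_pos {k : ℕ} (hk : k ≠ 0) : 0 < sphereArea k := by
  rw [sphereArea, if_neg hk]
  have := Real.Gamma_pos_of_pos (s := ((k : ℝ) + 1) / 2) (by positivity)
  positivity

theorem ae_norm_ne (hn : n ≠ 0) (r : ℝ) : ∀ᵐ x : EuclideanSpace ℝ (Fin n), ‖x‖ ≠ r := by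
  have : Nonempty (Fin n) := ⟨⟨0, Nat.pos_of_ne_zero hn⟩⟩
  simpa [ae_iff, sphere, dist_zero_right] using
    Measure.addHaar_sphere volume (0 : EuclideanSpace ℝ (Fin n)) r

theorem pow_pred_mul_inv_pow (hn : n ≠ 0) {a : ℝ} (ha : a ≠ 0) :
    a ^ (n - 1) * a⁻¹ ^ n = a⁻¹ := by
  obtain ⟨k, rfl⟩ := Nat.exists_eq_succ_of_ne_zero hn
  rw [Nat.succ_sub_one, Nat.succ_eq_add_one, pow_succ, inv_pow, ← mul_assoc,
    mul_inv_cancel₀ (pow_ne_zero k ha), one_mul]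

theorem lintegral_inv_norm_pow (hn : 2 ≤ n) (hr : 0 < r) (hrR : r ≤ R) :
    ∫⁻ x : EuclideanSpace ℝ (Fin n) in norm ⁻¹' Ioo r R, ENNReal.ofReal (‖x‖⁻¹ ^ n) =
      ENNReal.ofReal (sphereArea (n - 1)) * ENNReal.ofReal (Real.log (R / r)) := by
  have : Nonempty (Fin n) := ⟨⟨0, by lia⟩⟩
  have polar := lintegral_fun_norm_addHaar (volume : Measure (EuclideanSpace ℝ (Fin n)))
    (f := (Ioo r R).indicator fun s ↦ ENNReal.ofReal (s⁻¹ ^ n))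
    (Measurable.indicator (by fun_prop) measurableSet_Ioo)
  have radial : ∀ s ∈ Ioi (0 : ℝ), ENNReal.ofReal (s ^ (n - 1)) *
      (Ioo r R).indicator (fun s ↦ ENNReal.ofReal (s⁻¹ ^ n)) s =
        (Ioo r R).indicator (fun s ↦ ENNReal.ofReal s⁻¹) s := fun s (hs : 0 < s) ↦ by
    rw [← indicator_mul_right _ fun s ↦ ENNReal.ofReal (s ^ (n - 1))]
    by_cases h : s ∈ Ioo r R
    · rw [indicator_of_mem h, indicator_of_mem h, ← ENNReal.ofReal_mul (by positivity),
        pow_pred_mul_inv_pow (by lia) hs.ne']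
    · rw [indicator_of_notMem h, indicator_of_notMem h]
  rw [finrank_euclideanSpace_fin, natCast_mul_volume_unitBall hn,
    setLIntegral_congr_fun measurableSet_Ioi radial, setLIntegral_indicator measurableSet_Ioo,
    inter_eq_left.2 (Ioo_subset_Ioi_self.trans (Ioi_subset_Ioi hr.le)),
    lintegral_inv_Ioo hr hrR] at polar
  rw [← polar, ← lintegral_indicator (measurable_norm measurableSet_Ioo)]
  exact lintegral_congr fun x ↦ by simp [indicator]

theorem IsAdmissible.hasCompactSupport (hu : IsAdmissible O K u) :
    HasCompactSupport fun x ↦ 1 - u x :=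
  HasCompactSupport.intro hu.isCompact_closure fun x hx ↦ sub_eq_zero.2 <|
    ((hu.le_one x).eq_of_not_lt fun h ↦ hx (subset_closure ⟨hu.nonneg x, h⟩)).symm

theorem IsAdmissible.partialGrad_eq_zero_of_notMem (hu : IsAdmissible O K u)
    {x : EuclideanSpace ℝ (Fin n)} (hx : x ∉ O) : partialGrad u x = 0 := by
  have heq : u =ᶠ[𝓝 x] fun _ ↦ 1 := by
    filter_upwards [isClosed_closure.isOpen_compl.mem_nhds fun h ↦ hx (hu.closure_subset h)]
      with z hz
    exact (hu.le_one z).eq_of_not_lt fun h ↦ hz (subset_closure ⟨hu.nonneg z, h⟩)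
  rw [partialGrad_congr heq, partialGrad_const]

theorem IsAdmissible.partialGrad_eq_zero_of_mem_interior (hu : IsAdmissible O K u)
    {x : EuclideanSpace ℝ (Fin n)} (hx : x ∈ interior K) : partialGrad u x = 0 := by
  have heq : u =ᶠ[𝓝 x] fun _ ↦ 0 := by
    filter_upwards [mem_interior_iff_mem_nhds.1 hx] with z hz using hu.eq_zero z hz
  rw [partialGrad_congr heq, partialGrad_const]

theorem IsAdmissible.ae_partialGrad_eq_zero (hn : n ≠ 0)
    (hu : IsAdmissible (ball 0 R) (closedBall 0 r) u) :
    ∀ᵐ x, ‖x‖ ∉ Ioo r R → partialGrad u x = 0 := by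
  filter_upwards [ae_norm_ne hn r] with x hxr hx
  rcases lt_or_gt_of_ne hxr with h | h
  · exact hu.partialGrad_eq_zero_of_mem_interior
      (ball_subset_interior_closedBall (mem_ball_zero_iff.2 h))
  · exact hu.partialGrad_eq_zero_of_notMem fun h' ↦ hx ⟨h, mem_ball_zero_iff.1 h'⟩

theorem integrable_partialGrad_mul_radialField (hu : Continuous u) (hr : 0 < r)
    (hint : Integrable fun x ↦ ‖partialGrad u x‖ * ‖radialField r x‖) (i : Fin n) :
    Integrable fun x ↦ partialGrad u x i * radialField r x i := by
  refine hint.mono' ((measurable_lineDeriv hu).mul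
    ((EuclideanSpace.proj (𝕜 := ℝ) i).continuous.comp
      (continuous_radialField hr)).measurable).aestronglyMeasurable (ae_of_all _ fun x ↦ ?_)
  rw [norm_mul]
  exact mul_le_mul (PiLp.norm_apply_le _ i) (PiLp.norm_apply_le _ i) (norm_nonneg _)
    (norm_nonneg _)

theorem IsAdmissible.integrable_one_sub_mul_partialGrad_radialField (hn : n ≠ 0) (hr : 0 < r)
    (hu : IsAdmissible O K u) (i : Fin n) :
    Integrable fun x ↦ (1 - u x) * partialGrad (fun x ↦ radialField r x i) x i := by
  have hint : Integrable fun x ↦ 1 - u x :=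
    (continuous_const.sub hu.continuous).integrable_of_hasCompactSupport hu.hasCompactSupport
  refine hint.mul_bdd (c := r⁻¹ ^ n * (1 + n)) (measurable_lineDeriv
    ((EuclideanSpace.proj (𝕜 := ℝ) i).continuous.comp
      (continuous_radialField hr))).aestronglyMeasurable ?_
  filter_upwards [ae_norm_ne hn r] with x hx using norm_partialGrad_radialField_le hr hx i

theorem IsAdmissible.integral_partialGrad_mul_radialField (hn : n ≠ 0) (hr : 0 < r)
    (hu : IsAdmissible O K u)
    (hint : Integrable fun x ↦ ‖partialGrad u x‖ * ‖radialField r x‖) (i : Fin n) :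
    ∫ x, partialGrad u x i * radialField r x i =
      ∫ x, (1 - u x) * partialGrad (fun x ↦ radialField r x i) x i := by
  have hgrad : ∀ x, partialGrad (fun x ↦ 1 - u x) x i * radialField r x i =
      -(partialGrad u x i * radialField r x i) := fun x ↦ by
    rw [partialGrad_const_sub, PiLp.neg_apply, neg_mul]
  rw [integral_mul_partialGrad_eq_neg i ((isACL_const 1).sub hu.acl) (isACL_radialField hr i)
    hu.hasCompactSupport (hu.integrable_one_sub_mul_partialGrad_radialField hn hr i)
    ((integrable_partialGrad_mul_radialField hu.continuous hr hint i).neg.congr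
      (ae_of_all _ fun x ↦ (hgrad x).symm))]
  simp only [hgrad, integral_neg, neg_neg]

theorem integral_indicator_ball_inv_pow (hn : 2 ≤ n) (hr : 0 < r) :
    ∫ x : EuclideanSpace ℝ (Fin n), (ball 0 r).indicator (fun _ ↦ n * r⁻¹ ^ n) x =
      sphereArea (n - 1) := by
  have hσ := congrArg ENNReal.toReal (natCast_mul_volume_unitBall hn)
  rw [ENNReal.toReal_mul, ENNReal.toReal_natCast,
    ENNReal.toReal_ofReal (sphereArea_pos (by lia)).le] at hσ
  rw [integral_indicator measurableSet_ball, setIntegral_const, smul_eq_mul, Measure.real,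
    Measure.addHaar_ball_of_pos _ _ hr, ENNReal.toReal_mul, ENNReal.toReal_ofReal (by positivity),
    finrank_euclideanSpace_fin, inv_pow, ← hσ]
  field_simp

theorem IsAdmissible.integral_inner_partialGrad_radialField (hn : 2 ≤ n) (hr : 0 < r)
    (hu : IsAdmissible O (closedBall 0 r) u)
    (hint : Integrable fun x ↦ ‖partialGrad u x‖ * ‖radialField r x‖) :
    ∫ x, inner ℝ (partialGrad u x) (radialField r x) = sphereArea (n - 1) := by
  have hn0 : n ≠ 0 := by lia
  calc ∫ x, inner ℝ (partialGrad u x) (radialField r x)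
      = ∫ x, ∑ i, partialGrad u x i * radialField r x i := by
        simp [PiLp.inner_apply, mul_comm]
    _ = ∑ i, ∫ x, partialGrad u x i * radialField r x i :=
        integral_finsetSum _ fun i _ ↦
          integrable_partialGrad_mul_radialField hu.continuous hr hint i
    _ = ∑ i, ∫ x, (1 - u x) * partialGrad (fun x ↦ radialField r x i) x i :=
        Finset.sum_congr rfl fun i _ ↦ hu.integral_partialGrad_mul_radialField hn0 hr hint i
    _ = ∫ x, ∑ i, (1 - u x) * partialGrad (fun x ↦ radialField r x i) x i :=
        (integral_finsetSum _ fun i _ ↦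
          hu.integrable_one_sub_mul_partialGrad_radialField hn0 hr i).symm
    _ = ∫ x : EuclideanSpace ℝ (Fin n), (ball 0 r).indicator (fun _ ↦ n * r⁻¹ ^ n) x := by
        refine integral_congr_ae ?_
        filter_upwards [ae_norm_ne hn0 r] with x hx
        rw [← Finset.mul_sum, sum_partialGrad_radialField hr hx]
        by_cases h : x ∈ ball 0 r
        · rw [hu.eq_zero x (ball_subset_closedBall h), sub_zero, one_mul]
        · rw [indicator_of_notMem h, mul_zero]
    _ = sphereArea (n - 1) := integral_indicator_ball_inv_pow hn hr

theorem enorm_radialField_rpow (hn : 2 ≤ n) (hr : 0 < r) {x : EuclideanSpace ℝ (Fin n)}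
    (hx : r ≤ ‖x‖) :
    ‖radialField r x‖ₑ ^ ((n : ℝ) / (n - 1)) = ENNReal.ofReal (‖x‖⁻¹ ^ n) := by
  have hx0 : 0 < ‖x‖ := hr.trans_le hx
  have hn1 : (1 : ℝ) < n := by exact_mod_cast hn
  have hnorm : ‖radialField r x‖ = ‖x‖⁻¹ ^ (n - 1) := by
    obtain ⟨k, rfl⟩ : ∃ k, n = k + 1 := ⟨n - 1, by lia⟩
    rw [radialField_of_le_norm hx, norm_smul, norm_pow, norm_inv, norm_norm, pow_succ,
      inv_mul_cancel_right₀ hx0.ne', Nat.add_sub_cancel]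
  rw [← ofReal_norm, hnorm,
    ENNReal.ofReal_rpow_of_nonneg (by positivity) (div_nonneg (by positivity) (by linarith)),
    ← Real.rpow_natCast, ← Real.rpow_mul (by positivity), Nat.cast_sub (by lia), Nat.cast_one,
    mul_div_cancel₀ _ (by linarith), Real.rpow_natCast]

theorem ofReal_gradNorm_pow (u : EuclideanSpace ℝ (Fin n) → ℝ) (x : EuclideanSpace ℝ (Fin n))
    (k : ℕ) : ENNReal.ofReal (gradNorm u x ^ k) = ‖partialGrad u x‖ₑ ^ k := by
  rw [gradNorm_eq_norm_partialGrad, ENNReal.ofReal_pow (norm_nonneg _), ofReal_norm]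

theorem IsAdmissible.lintegral_enorm_partialGrad_mul_radialField_le (hn : 2 ≤ n) (hr : 0 < r)
    (hrR : r ≤ R) (hu : IsAdmissible (ball 0 R) (closedBall 0 r) u) :
    ∫⁻ x, ‖partialGrad u x‖ₑ * ‖radialField r x‖ₑ ≤
      (∫⁻ x, ‖partialGrad u x‖ₑ ^ n) ^ (1 / (n : ℝ)) *
        (ENNReal.ofReal (sphereArea (n - 1)) * ENNReal.ofReal (Real.log (R / r))) ^
          (1 / ((n : ℝ) / (n - 1))) := by
  have hms : MeasurableSet (norm ⁻¹' Ioo r R : Set (EuclideanSpace ℝ (Fin n))) :=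
    measurable_norm measurableSet_Ioo
  have hpq : (n : ℝ).HolderConjugate (n / (n - 1)) :=
    Real.HolderConjugate.conjExponent (by exact_mod_cast hn)
  have hsupp : ∫⁻ x, ‖partialGrad u x‖ₑ * ‖radialField r x‖ₑ =
      ∫⁻ x in norm ⁻¹' Ioo r R, ‖partialGrad u x‖ₑ * ‖radialField r x‖ₑ := by
    rw [← lintegral_indicator hms]
    refine lintegral_congr_ae ?_
    filter_upwards [hu.ae_partialGrad_eq_zero (by lia)] with x hx
    by_cases hxA : x ∈ norm ⁻¹' Ioo r R
    · rw [indicator_of_mem hxA]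
    · rw [indicator_of_notMem hxA, hx hxA, enorm_zero, zero_mul]
  rw [hsupp]
  refine (ENNReal.lintegral_mul_le_Lp_mul_Lq (volume.restrict _) hpq
    (measurable_partialGrad hu.continuous).enorm.aemeasurable
    (continuous_radialField hr).measurable.enorm.aemeasurable).trans ?_
  refine mul_le_mul' (ENNReal.rpow_le_rpow ?_ hpq.one_div_nonneg)
    (ENNReal.rpow_le_rpow ?_ hpq.symm.one_div_nonneg)
  · simp only [ENNReal.rpow_natCast]
    exact setLIntegral_le_lintegral _ _
  · rw [← lintegral_inv_norm_pow hn hr hrR]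
    exact (setLIntegral_congr_fun hms fun x hx ↦ enorm_radialField_rpow hn hr hx.1.le).le

theorem div_pow_pred_le_of_le_rpow_mul_rpow {a J L : ℝ≥0∞} (hn : n ≠ 0) (ha : a ≠ 0) (ha' : a ≠ ⊤)
    (hL : L ≠ 0) (hL' : L ≠ ⊤)
    (h : a ≤ J ^ (1 / (n : ℝ)) * (a * L) ^ (1 / ((n : ℝ) / (n - 1)))) : a / L ^ (n - 1) ≤ J := by
  obtain ⟨k, rfl⟩ := Nat.exists_eq_succ_of_ne_zero hn
  have hk : (k.succ : ℝ) ≠ 0 := by positivity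
  have hpow := pow_le_pow_left₀ zero_le h (k + 1)
  rw [mul_pow, ← ENNReal.rpow_mul_natCast, ← ENNReal.rpow_mul_natCast, one_div_mul_cancel hk,
    one_div_div, div_mul_cancel₀ _ hk, ENNReal.rpow_one, Nat.cast_succ, add_sub_cancel_right,
    ENNReal.rpow_natCast, mul_pow, pow_succ', mul_left_comm] at hpow
  rw [ENNReal.div_le_iff (by simp [hL]) (by finiteness)]
  exact (ENNReal.mul_le_mul_iff_right (pow_ne_zero k ha) (ENNReal.pow_ne_top ha')).1
    (mul_comm a (a ^ k) ▸ hpow)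

theorem IsAdmissible.le_lintegral_gradNorm (hn : 2 ≤ n) (hr : 0 < r) (hrR : r < R)
    (hu : IsAdmissible (ball 0 R) (closedBall 0 r) u) :
    ENNReal.ofReal (sphereArea (n - 1)) / ENNReal.ofReal (Real.log (R / r)) ^ (n - 1) ≤
      ∫⁻ x, ENNReal.ofReal (gradNorm u x ^ n) := by
  have hσ : 0 < sphereArea (n - 1) := sphereArea_pos (by lia)
  have hL : 0 < Real.log (R / r) := Real.log_pos ((one_lt_div hr).2 hrR)
  have hn1 : (1 : ℝ) < n := by exact_mod_cast hn
  simp only [ofReal_gradNorm_pow]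
  rcases eq_or_ne (∫⁻ x, ‖partialGrad u x‖ₑ ^ n) ⊤ with htop | hfin
  · exact htop ▸ le_top
  have hholder := hu.lintegral_enorm_partialGrad_mul_radialField_le hn hr hrR.le
  have hint : Integrable fun x ↦ ‖partialGrad u x‖ * ‖radialField r x‖ := by
    refine ⟨((measurable_partialGrad hu.continuous).norm.mul
      (continuous_radialField hr).measurable.norm).aestronglyMeasurable, ?_⟩
    simp only [HasFiniteIntegral, enorm_mul, enorm_norm]
    refine hholder.trans_lt (ENNReal.mul_lt_top ?_ ?_) <;>
      refine ENNReal.rpow_lt_top_of_nonneg ?_ (by finiteness)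
    · positivity
    · exact one_div_nonneg.2 (div_nonneg (by positivity) (by linarith))
  refine div_pow_pred_le_of_le_rpow_mul_rpow (by lia) (by simpa using hσ) ENNReal.ofReal_ne_top
    (by simpa using hL) ENNReal.ofReal_ne_top (le_trans ?_ hholder)
  calc ENNReal.ofReal (sphereArea (n - 1))
      = ‖∫ x, inner ℝ (partialGrad u x) (radialField r x)‖ₑ := by
        rw [hu.integral_inner_partialGrad_radialField hn hr hint, Real.enorm_of_nonneg hσ.le]
    _ ≤ ∫⁻ x, ‖inner ℝ (partialGrad u x) (radialField r x)‖ₑ :=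
        enorm_integral_le_lintegral_enorm _
    _ ≤ ∫⁻ x, ‖partialGrad u x‖ₑ * ‖radialField r x‖ₑ := lintegral_mono fun x ↦ by
        simp only [← ofReal_norm]
        rw [← ENNReal.ofReal_mul (norm_nonneg _)]
        exact ENNReal.ofReal_le_ofReal (norm_inner_le_norm _ _)

end LowerBound

section RingFunction

variable {n : ℕ} {r R S : ℝ} {x : EuclideanSpace ℝ (Fin n)}

/-- The extremal function of the spherical ring with radii `r < S`. -/
noncomputable def ringFunction (r S : ℝ) (x : EuclideanSpace ℝ (Fin n)) : ℝ :=
  min 1 ((Real.log (S / r))⁻¹ * Real.log (max ‖x‖ r / r))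

theorem log_div_sub_log_div_le {a b : ℝ} (hr : 0 < r) (ha : r ≤ a) (hb : r ≤ b) :
    Real.log (a / r) - Real.log (b / r) ≤ r⁻¹ * |a - b| := by
  have ha0 := hr.trans_le ha
  have hb0 := hr.trans_le hb
  rw [← Real.log_div (by positivity) (by positivity), div_div_div_cancel_right₀ hr.ne']
  calc Real.log (a / b) ≤ a / b - 1 := Real.log_le_sub_one_of_pos (by positivity)
    _ = b⁻¹ * (a - b) := by field_simp
    _ ≤ b⁻¹ * |a - b| := by gcongr; exact le_abs_self _
    _ ≤ r⁻¹ * |a - b| := by gcongr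

theorem lipschitzWith_log_max_norm {E : Type*} [SeminormedAddCommGroup E] (hr : 0 < r) :
    LipschitzWith (Real.toNNReal r⁻¹) fun x : E ↦ Real.log (max ‖x‖ r / r) :=
  LipschitzWith.of_le_add_mul _ fun x y ↦ by
    rw [Real.coe_toNNReal _ (by positivity), ← sub_le_iff_le_add']
    refine (log_div_sub_log_div_le hr (le_max_right _ _) (le_max_right _ _)).trans ?_
    gcongr
    exact abs_max_norm_sub_max_norm_le r x y

theorem exists_lipschitzWith_ringFunction (hr : 0 < r) (S : ℝ) : ∃ C : NNReal,
    LipschitzWith C (ringFunction r S : EuclideanSpace ℝ (Fin n) → ℝ) :=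
  ⟨_, ((lipschitzWith_smul (Real.log (S / r))⁻¹).comp
    (lipschitzWith_log_max_norm hr)).const_min 1⟩

theorem ringFunction_lt_one_iff (hr : 0 < r) (hrS : r < S) : ringFunction r S x < 1 ↔ ‖x‖ < S := by
  have hL : 0 < Real.log (S / r) := Real.log_pos ((one_lt_div hr).2 hrS)
  have : 0 < max ‖x‖ r := lt_max_of_lt_right hr
  rw [ringFunction, min_lt_iff, or_iff_right (lt_irrefl 1),
    inv_mul_lt_one₀ hL, Real.log_lt_log_iff (by positivity) (div_pos (hr.trans hrS) hr),
    div_lt_div_iff_of_pos_right hr, max_lt_iff, and_iff_left hrS]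

theorem ringFunction_of_le_norm (hr : 0 < r) (hrS : r < S) (hx : S ≤ ‖x‖) :
    ringFunction r S x = 1 :=
  (min_le_left 1 _).eq_of_not_lt fun h ↦ hx.not_gt ((ringFunction_lt_one_iff hr hrS).1 h)

theorem isAdmissible_ringFunction (hr : 0 < r) (hrS : r < S) (hSR : S < R) :
    IsAdmissible (ball 0 R) (closedBall 0 r)
      (ringFunction r S : EuclideanSpace ℝ (Fin n) → ℝ) := by
  obtain ⟨C, hC⟩ := exists_lipschitzWith_ringFunction (n := n) hr S
  have hL : 0 < Real.log (S / r) := Real.log_pos ((one_lt_div hr).2 hrS)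
  have hclosure : closure {x : EuclideanSpace ℝ (Fin n) |
      0 ≤ ringFunction r S x ∧ ringFunction r S x < 1} ⊆ closedBall 0 S :=
    closure_minimal (fun x hx ↦ mem_closedBall_zero_iff.2
      ((ringFunction_lt_one_iff hr hrS).1 hx.2).le) isClosed_closedBall
  exact
    { continuous := hC.continuous
      acl := isACL_of_lipschitzWith hC
      nonneg := fun x ↦ le_min zero_le_one (mul_nonneg (inv_nonneg.2 hL.le)
        (Real.log_nonneg ((one_le_div hr).2 (le_max_right _ _))))
      le_one := fun x ↦ min_le_left _ _
      eq_zero := fun x hx ↦ by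
        simp [ringFunction, max_eq_right (mem_closedBall_zero_iff.1 hx), hr.ne']
      isCompact_closure := (isCompact_closedBall _ _).of_isClosed_subset isClosed_closure hclosure
      closure_subset := hclosure.trans (closedBall_subset_ball hSR) }

theorem partialGrad_ringFunction (hr : 0 < r) (hx : ‖x‖ ∈ Ioo r S) :
    partialGrad (ringFunction r S) x = ((Real.log (S / r))⁻¹ * (‖x‖ ^ 2)⁻¹) • x := by
  have hx0 : 0 < ‖x‖ := hr.trans hx.1
  have heq : ringFunction r S =ᶠ[𝓝 x] fun x ↦ (Real.log (S / r))⁻¹ * Real.log (‖x‖ / r) := by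
    filter_upwards [continuous_norm.continuousAt.preimage_mem_nhds (isOpen_Ioo.mem_nhds hx)]
      with z hz
    have hlt := (ringFunction_lt_one_iff hr (hx.1.trans hx.2)).2 hz.2
    rw [ringFunction] at hlt ⊢
    rw [min_eq_right ((min_lt_iff.1 hlt).resolve_left (lt_irrefl _)).le, max_eq_left hz.1.le]
  rw [partialGrad_congr heq]
  ext i
  have hderiv := (((hasLineDerivAt_norm (norm_pos_iff.1 hx0) i).div_const r).log
    (by simpa using ⟨norm_pos_iff.1 hx0, hr.ne'⟩)).const_mul (Real.log (S / r))⁻¹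
  refine hderiv.deriv.trans ?_
  simp only [zero_smul, add_zero, PiLp.smul_apply, smul_eq_mul]
  field_simp

theorem enorm_partialGrad_ringFunction (hr : 0 < r) (hx : ‖x‖ ∈ Ioo r S) :
    ‖partialGrad (ringFunction r S) x‖ₑ =
      ENNReal.ofReal ((Real.log (S / r))⁻¹) * ENNReal.ofReal ‖x‖⁻¹ := by
  have hx0 : 0 < ‖x‖ := hr.trans hx.1
  have hL : 0 < Real.log (S / r) := Real.log_pos ((one_lt_div hr).2 (hx.1.trans hx.2))
  rw [← ENNReal.ofReal_mul (by positivity), partialGrad_ringFunction hr hx, ← ofReal_norm,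
    norm_smul, Real.norm_of_nonneg (by positivity)]
  congr 1
  field_simp

theorem ae_partialGrad_ringFunction_eq_zero (hn : n ≠ 0) (hr : 0 < r) (hrS : r < S) :
    ∀ᵐ x : EuclideanSpace ℝ (Fin n), ‖x‖ ∉ Ioo r S → partialGrad (ringFunction r S) x = 0 := by
  filter_upwards [(isAdmissible_ringFunction hr hrS (lt_add_one S)).ae_partialGrad_eq_zero hn,
    ae_norm_ne hn S] with x hx hxS hxA
  by_cases h : S < ‖x‖
  · have heq : ringFunction r S =ᶠ[𝓝 x] fun _ ↦ 1 := by
      filter_upwards [continuous_norm.continuousAt.eventually_const_lt h] with z hz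
      exact ringFunction_of_le_norm hr hrS hz.le
    rw [partialGrad_congr heq, partialGrad_const]
  · exact hx fun h' ↦ hxA ⟨h'.1, (not_lt.1 h).lt_of_ne hxS⟩

theorem lintegral_gradNorm_ringFunction (hn : 2 ≤ n) (hr : 0 < r) (hrS : r < S) :
    ∫⁻ x : EuclideanSpace ℝ (Fin n), ENNReal.ofReal (gradNorm (ringFunction r S) x ^ n) =
      ENNReal.ofReal (sphereArea (n - 1)) / ENNReal.ofReal (Real.log (S / r)) ^ (n - 1) := by
  have hn0 : n ≠ 0 := by lia
  have hL : 0 < Real.log (S / r) := Real.log_pos ((one_lt_div hr).2 hrS)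
  simp only [ofReal_gradNorm_pow]
  calc ∫⁻ x : EuclideanSpace ℝ (Fin n), ‖partialGrad (ringFunction r S) x‖ₑ ^ n
      = ∫⁻ x : EuclideanSpace ℝ (Fin n) in norm ⁻¹' Ioo r S,
          ENNReal.ofReal ((Real.log (S / r))⁻¹) ^ n * ENNReal.ofReal (‖x‖⁻¹ ^ n) := by
        rw [← lintegral_indicator (measurable_norm measurableSet_Ioo)]
        refine lintegral_congr_ae ?_
        filter_upwards [ae_partialGrad_ringFunction_eq_zero hn0 hr hrS] with x hx
        by_cases hxA : x ∈ norm ⁻¹' Ioo r S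
        · rw [indicator_of_mem hxA, enorm_partialGrad_ringFunction hr hxA, mul_pow,
            ← ENNReal.ofReal_pow (inv_nonneg.2 (norm_nonneg x))]
        · rw [indicator_of_notMem hxA, hx hxA, enorm_zero, zero_pow hn0]
    _ = ENNReal.ofReal ((Real.log (S / r))⁻¹) ^ n *
          (ENNReal.ofReal (sphereArea (n - 1)) * ENNReal.ofReal (Real.log (S / r))) := by
        rw [lintegral_const_mul _ (by fun_prop), lintegral_inv_norm_pow hn hr hrS.le]
    _ = ENNReal.ofReal (sphereArea (n - 1)) / ENNReal.ofReal (Real.log (S / r)) ^ (n - 1) := by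
        obtain ⟨k, rfl⟩ := Nat.exists_eq_succ_of_ne_zero hn0
        rw [ENNReal.ofReal_inv_of_pos hL, Nat.succ_sub_one, pow_succ, mul_mul_mul_comm, mul_comm,
          ENNReal.inv_mul_cancel (by simpa using hL) ENNReal.ofReal_ne_top, one_mul, mul_comm,
          ← ENNReal.inv_pow, ← div_eq_mul_inv]

theorem condCap_ring (hn : 2 ≤ n) (hr : 0 < r) (hrR : r < R) :
    condCap (ball (0 : EuclideanSpace ℝ (Fin n)) R) (closedBall 0 r) =
      ENNReal.ofReal (sphereArea (n - 1)) / ENNReal.ofReal (Real.log (R / r)) ^ (n - 1) := by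
  refine le_antisymm ?_ (le_iInf₂ fun u hu ↦ hu.le_lintegral_gradNorm hn hr hrR)
  have hlog : ContinuousAt (fun S ↦ Real.log (S / r)) R :=
    ContinuousAt.log (by fun_prop) (div_pos (hr.trans hrR) hr).ne'
  have hlim : Tendsto (fun S ↦ ENNReal.ofReal (sphereArea (n - 1)) /
      ENNReal.ofReal (Real.log (S / r)) ^ (n - 1)) (𝓝[<] R)
      (𝓝 (ENNReal.ofReal (sphereArea (n - 1)) / ENNReal.ofReal (Real.log (R / r)) ^ (n - 1))) :=
    ENNReal.Tendsto.const_div (ENNReal.Tendsto.pow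
      (ENNReal.tendsto_ofReal (hlog.tendsto.mono_left nhdsWithin_le_nhds)))
      (Or.inr ENNReal.ofReal_ne_top)
  -- The ring function of radii `r < S` is admissible only for `S < R`.
  refine ge_of_tendsto hlim ?_
  filter_upwards [Ioo_mem_nhdsLT hrR] with S hS
  rw [← lintegral_gradNorm_ringFunction hn hr hS.1]
  exact iInf₂_le _ (isAdmissible_ringFunction hr hS.1 hS.2)

end RingFunction

section BallCapacity

variable {n : ℕ} {r R : ℝ}

theorem nmod_ring (hn : 2 ≤ n) (hr : 0 < r) (hrR : r < R) :
    nmod (ball (0 : EuclideanSpace ℝ (Fin n)) R) (closedBall 0 r) =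
      ENNReal.ofReal (Real.log (R / r)) := by
  have hL : 0 < Real.log (R / r) := Real.log_pos ((one_lt_div hr).2 hrR)
  have hσ : 0 < sphereArea (n - 1) := sphereArea_pos (by lia)
  have hn1 : (1 : ℝ) - n ≠ 0 := by
    have : (2 : ℝ) ≤ n := by exact_mod_cast hn
    linarith
  rw [nmod, condCap_ring hn hr hrR, ← ENNReal.ofReal_pow hL.le,
    ← ENNReal.ofReal_div_of_pos (by positivity), ← ENNReal.ofReal_div_of_pos hσ,
    div_div_cancel_left' hσ.ne', ENNReal.ofReal_rpow_of_pos (by positivity)]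
  congr 1
  rw [← Real.rpow_natCast, ← Real.rpow_neg hL.le, ← Real.rpow_mul hL.le, Nat.cast_sub (by lia),
    Nat.cast_one, neg_sub, mul_one_div_cancel hn1, Real.rpow_one]

theorem tendsto_reducedMod_closedBall (hn : 2 ≤ n) (hr : 0 < r) :
    Tendsto (reducedMod (closedBall (0 : EuclideanSpace ℝ (Fin n)) r)) atTop
      (𝓝 ((-Real.log r : ℝ) : EReal)) := by
  refine tendsto_const_nhds.congr' ?_
  filter_upwards [eventually_gt_atTop r] with R hR
  have hL : 0 < Real.log (R / r) := Real.log_pos ((one_lt_div hr).2 hR)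
  rw [reducedMod, nmod_ring hn hr hR, EReal.coe_ennreal_ofReal, max_eq_left hL.le,
    ← EReal.coe_sub, Real.log_div (hr.trans hR).ne' hr.ne', sub_sub_cancel_left]

theorem ncap1_closedBall (hn : 2 ≤ n) (hr : 0 < r) :
    ncap1 (closedBall (0 : EuclideanSpace ℝ (Fin n)) r) = ENNReal.ofReal r := by
  rw [ncap1, (tendsto_reducedMod_closedBall hn hr).limUnder_eq, ← EReal.coe_neg, neg_neg,
    EReal.exp_coe, Real.exp_log hr]

theorem neg_ballRobin_eq (m : ℕ) :
    -ballRobin m = sphereArea m / (2 * sphereArea (m + 1)) *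
      ∫ θ in (0 : ℝ)..Real.pi, Real.sin θ ^ m * Real.log (2 * (1 - Real.cos θ)) := by
  have hsine : logSineIntegral m 1 =
      ∫ θ in (0 : ℝ)..Real.pi, Real.sin θ ^ m * Real.log (2 * (1 - Real.cos θ)) := by
    rw [logSineIntegral]
    refine intervalIntegral.integral_congr fun θ _ ↦ ?_
    simp only [logSqDist]
    ring_nf
  rw [ballRobin, neg_neg, ← hsine]
  rcases eq_or_ne m 0 with rfl | hm
  · rw [logSineIntegral_zero_left (by simp), mul_zero, mul_zero]
  · rw [← sphereArea_div_sphereArea hm, div_div, mul_comm 2]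

theorem ballRobin_eq_zero_iff (m : ℕ) : ballRobin m = 0 ↔ m = 0 := by
  rw [ballRobin, neg_eq_zero]
  constructor
  · contrapose!
    exact fun hm ↦ (mul_pos (half_pos (sinPowConst_pos m)) (logSineIntegral_one_pos hm)).ne'
  · rintro rfl
    rw [logSineIntegral_zero_left (by simp), mul_zero]

theorem ncap3_closedBall_eq_ofReal_mul_exp_integral (m : ℕ) (hr : 0 < r) :
    ncap3 (closedBall (0 : EuclideanSpace ℝ (Fin (m + 2))) r) =
      ENNReal.ofReal (r * Real.exp (sphereArea m / (2 * sphereArea (m + 1)) *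
        ∫ θ in (0 : ℝ)..Real.pi, Real.sin θ ^ m * Real.log (2 * (1 - Real.cos θ)))) := by
  rw [ncap3_closedBall m hr, neg_ballRobin_eq]

theorem ncap1_closedBall_eq_ncap3_closedBall_iff (m : ℕ) (hr : 0 < r) :
    ncap1 (closedBall (0 : EuclideanSpace ℝ (Fin (m + 2))) r) =
      ncap3 (closedBall (0 : EuclideanSpace ℝ (Fin (m + 2))) r) ↔ m = 0 := by
  rw [ncap1_closedBall (by lia) hr, ncap3_closedBall m hr,
    ENNReal.ofReal_eq_ofReal_iff hr.le (by positivity), left_eq_mul₀ hr.ne', Real.exp_eq_one_iff,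
    neg_eq_zero, ballRobin_eq_zero_iff]

end BallCapacity

end ConformalCapacity

theorem theorem2p2_general (n : ℕ) (hn : 2 ≤ n) :
    (∀ K : Set (EuclideanSpace ℝ (Fin n)), Bornology.IsBounded K →
      ∃ L : EReal,
        Tendsto (fun r : ℝ ↦
          ConformalCapacity.nmd (Metric.ball (0 : EuclideanSpace ℝ (Fin n)) r) K
            - (Real.log r : EReal)) atTop (𝓝 L) ∧
        ConformalCapacity.ncap3 K =
          EReal.exp (-L) /
            ConformalCapacity.ncap3 (Metric.closedBall (0 : EuclideanSpace ℝ (Fin n)) 1)) ∧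
    (∀ r : ℝ, 0 < r →
      (∃ L : EReal, Tendsto (ConformalCapacity.reducedMod
        (Metric.closedBall (0 : EuclideanSpace ℝ (Fin n)) r)) atTop (𝓝 L)) ∧
      ConformalCapacity.ncap1 (Metric.closedBall (0 : EuclideanSpace ℝ (Fin n)) r) =
        ENNReal.ofReal r ∧
      ConformalCapacity.ncap3 (Metric.closedBall (0 : EuclideanSpace ℝ (Fin n)) r) =
        ENNReal.ofReal (r * Real.exp
          (ConformalCapacity.sphereArea (n - 2) / (2 * ConformalCapacity.sphereArea (n - 1)) *
            ∫ θ in (0 : ℝ)..Real.pi,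
              Real.sin θ ^ (n - 2) * Real.log (2 * (1 - Real.cos θ)))) ∧
      (ConformalCapacity.ncap1 (Metric.closedBall (0 : EuclideanSpace ℝ (Fin n)) r) =
        ConformalCapacity.ncap3 (Metric.closedBall (0 : EuclideanSpace ℝ (Fin n)) r) ↔
          n = 2)) := by
  obtain ⟨m, rfl⟩ : ∃ m, n = m + 2 := ⟨n - 2, by lia⟩
  exact ⟨fun K hK ↦ ⟨_, ConformalCapacity.tendsto_nmd_sub_log hK,
      ConformalCapacity.ncap3_eq_exp_div K⟩,
    fun r hr ↦ ⟨⟨_, ConformalCapacity.tendsto_reducedMod_closedBall hn hr⟩,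
      ConformalCapacity.ncap1_closedBall hn hr,
      ConformalCapacity.ncap3_closedBall_eq_ofReal_mul_exp_integral m hr,
      (ConformalCapacity.ncap1_closedBall_eq_ncap3_closedBall_iff m hr).trans (by lia)⟩⟩

theorem theorem2p2 (n : ℕ) (hn : 2 ≤ n) :
    (∀ K : Set (EuclideanSpace ℝ (Fin n)), IsCompact K →
      ∃ L : EReal,
        Tendsto (fun r : ℝ =>
          ConformalCapacity.nmd (Metric.ball (0 : EuclideanSpace ℝ (Fin n)) r) K
            - (Real.log r : EReal)) atTop (𝓝 L) ∧
        ConformalCapacity.ncap3 K =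
          EReal.exp (-L) /
            ConformalCapacity.ncap3 (Metric.closedBall (0 : EuclideanSpace ℝ (Fin n)) 1)) ∧
    (∀ r : ℝ, 0 < r →
      (∃ L : EReal, Tendsto (ConformalCapacity.reducedMod
        (Metric.closedBall (0 : EuclideanSpace ℝ (Fin n)) r)) atTop (𝓝 L)) ∧
      ConformalCapacity.ncap1 (Metric.closedBall (0 : EuclideanSpace ℝ (Fin n)) r) =
        ENNReal.ofReal r ∧
      ConformalCapacity.ncap3 (Metric.closedBall (0 : EuclideanSpace ℝ (Fin n)) r) =
        ENNReal.ofReal (r * Real.exp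
          (ConformalCapacity.sphereArea (n - 2) / (2 * ConformalCapacity.sphereArea (n - 1)) *
            ∫ θ in (0 : ℝ)..Real.pi,
              Real.sin θ ^ (n - 2) * Real.log (2 * (1 - Real.cos θ)))) ∧
      (ConformalCapacity.ncap1 (Metric.closedBall (0 : EuclideanSpace ℝ (Fin n)) r) =
        ConformalCapacity.ncap3 (Metric.closedBall (0 : EuclideanSpace ℝ (Fin n)) r) ↔
          n = 2)) :=
  ⟨fun K hK ↦ (theorem2p2_general n hn).1 K hK.isBounded, (theorem2p2_general n hn).2⟩
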